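/- Let $\mathrm{K}=[0,1]^2$ and let $\mathcal{M}(\mathrm{K})$ be the space of real-valued bounded (signed) Borel measures on $\mathbb{R}^2$ supported in $\mathrm{K}$, with the total-variation norm $\|\cdot\|_{\mathcal{M}}$. Let $\mathcal{M}_{\mathrm{D}\otimes\mathrm{D},0}(\mathrm{K})$ be the space of real distributions $f\in\mathcal{D}'(\mathbb{R}^2)$ such that the mixed derivative $[\mathrm{D}\otimes\mathrm{D}]\{f\}=\partial_1\partial_2 f$ belongs to $\mathcal{M}(\mathrm{K})$ and $\langle f,\phi\rangle=0$ for all $\phi\in\mathcal{C}_c^\infty(\mathbb{R}^2\setminus\mathrm{K})$. For such $f$ put $\|\nabla\{f\}\|_{\mathcal{M}^2}=\|\partial_1 f\|_{\mathcal{M}}+\|\partial_2 f\|_{\mathcal{M}}$. A sequence $(f_n)$ in $\mathcal{M}_{\mathrm{D}\otimes\mathrm{D},0}(\mathrm{K})$ is weak$^\star$-convergent to $f$ if $\langle f_n,[\mathrm{D}\otimes\mathrm{D}]\{\varphi\}\rangle\to\langle f,[\mathrm{D}\otimes\mathrm{D}]\{\varphi\}\rangle$ for every $\varphi\in\mathcal{C}_0(\mathbb{R}^2)$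 (continuous functions vanishing at infinity), where $\langle f,[\mathrm{D}\otimes\mathrm{D}]\{\varphi\}\rangle=\int\varphi\,\mathrm{d}\big([\mathrm{D}\otimes\mathrm{D}]\{f\}\big)$. Then, for every $f\in\mathcal{M}_{\mathrm{D}\otimes\mathrm{D},0}(\mathrm{K})$, there exists a sequence $(f_n)_{n=1}^\infty$ in $\mathcal{M}_{\mathrm{D}\otimes\mathrm{D},0}(\mathrm{K})$ such that, for every $n\geq 1$, $[\mathrm{D}\otimes\mathrm{D}]\{f_n\}$ is a discrete measure supported on the grid $\frac1n\{1,\dots,n\}\times\frac1n\{1,\dots,n\}$, and such that 1. $(f_n)$ is weak$^\star$-convergent to $f$; 2. $\|[\mathrm{D}\otimes\mathrm{D}]\{f_n\}\|_{\mathcal{M}}\leq\|[\mathrm{D}\otimes\mathrm{D}]\{f\}\|_{\mathcal{M}}<\infty$ for every $n\geq1$, and $\lim_{n\to\infty}\|[\mathrm{D}\otimes\mathrm{D}]\{f_n\}\|_{\mathcal{M}}=\|[\mathrm{D}\otimes\mathrm{D}]\{f\}\|_{\mathcal{M}}$; 3. $f$ and all the $f_n$ are integrable functions, and $f_n\to f$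 in $\mathcal{L}_1(\mathrm{K})$; 4. $\|\nabla\{f\}\|_{\mathcal{M}^2}$ and all the $\|\nabla\{f_n\}\|_{\mathcal{M}^2}$ are finite (the first partial derivatives belong to $\mathcal{M}(\mathrm{K})$), and $\lim_{n\to\infty}\|\nabla\{f_n\}\|_{\mathcal{M}^2}=\|\nabla\{f\}\|_{\mathcal{M}^2}$. -/

import Mathlib

open MeasureTheory TopologicalSpace Filter
open scoped Distributions LineDeriv Topology ENNReal ZeroAtInfty

noncomputable section

namespace MixedTV

/-- Real-valued distributions on the plane, i.e. `𝓓'(ℝ²)`. The plane is modelled as `ℝ × ℝ`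
with its usual topology and Lebesgue measure. -/
abbrev PlaneDistribution : Type := 𝓓'((⊤ : Opens (ℝ × ℝ)), ℝ)

/-- The closed unit square `K = [0,1]²`. -/
def unitSquare : Set (ℝ × ℝ) := Set.Icc 0 1 ×ˢ Set.Icc 0 1

/-- The signed measure `μ` is supported in `K`, i.e. `μ ∈ 𝓜(K)`. Signed measures are
real-valued, hence bounded. -/
def SupportedInSquare (μ : SignedMeasure (ℝ × ℝ)) : Prop :=
  ∀ A : Set (ℝ × ℝ), MeasurableSet A → A ⊆ unitSquareᶜ → μ A = 0

/-- The distribution `T` is the signed measure `μ`: `⟨T, φ⟩ = ∫ φ dμ` for all test functions. -/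
def IsMeasure (T : PlaneDistribution) (μ : SignedMeasure (ℝ × ℝ)) : Prop :=
  ∀ φ : 𝓓((⊤ : Opens (ℝ × ℝ)), ℝ), T φ = ∫ᵛ x, φ x ∂<•μ

/-- A signed measure is determined by its integrals against test functions, so a distribution
is at most one measure. -/
theorem IsMeasure.unique {T : PlaneDistribution} {μ ν : SignedMeasure (ℝ × ℝ)}
    (hμ : IsMeasure T μ) (hν : IsMeasure T ν) : μ = ν := by
  rw [← sub_eq_zero]
  set s : SignedMeasure (ℝ × ℝ) := μ - ν with hs
  have hfin (κ : SignedMeasure (ℝ × ℝ)) : IsFiniteMeasure κ.variation := by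
    rw [← κ.totalVariation_eq_variation]
    unfold SignedMeasure.totalVariation
    infer_instance
  set a := s.toJordanDecomposition.posPart
  set b := s.toJordanDecomposition.negPart
  have hsab : s = a.toSignedMeasure - b.toSignedMeasure :=
    s.toSignedMeasure_toJordanDecomposition.symm
  obtain ⟨S, hS, haS, hbS⟩ := s.toJordanDecomposition.mutuallySingular
  have hint (g : ℝ × ℝ → ℝ) (hg : ContDiff ℝ (⊤ : ℕ∞) g) (hgs : HasCompactSupport g)
      (κ : Measure (ℝ × ℝ)) [IsFiniteMeasure κ] : Integrable g κ :=
    hg.continuous.integrable_of_hasCompactSupport hgs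
  have key (g : ℝ × ℝ → ℝ) (hg : ContDiff ℝ (⊤ : ℕ∞) g) (hgs : HasCompactSupport g) :
      ∫ x, g x ∂a = ∫ x, g x ∂b := by
    have h1 : ∫ᵛ x, g x ∂<•μ = ∫ᵛ x, g x ∂<•ν :=
      (hμ ⟨g, hg, hgs, by simp⟩).symm.trans (hν ⟨g, hg, hgs, by simp⟩)
    have h2 : ∫ᵛ x, g x ∂<•s = 0 := by
      have := hfin μ
      have := hfin ν
      rw [hs, VectorMeasure.integral_sub_vectorMeasure (hint g hg hgs _) (hint g hg hgs _), h1,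
        sub_self]
    rw [hsab, VectorMeasure.integral_sub_vectorMeasure
      (by simpa [VectorMeasure.Integrable] using hint g hg hgs a)
      (by simpa [VectorMeasure.Integrable] using hint g hg hgs b),
      VectorMeasure.integral_toSignedMeasure, VectorMeasure.integral_toSignedMeasure] at h2
    linarith
  -- the density of `s` with respect to `a + b`
  set h : ℝ × ℝ → ℝ := Sᶜ.indicator 1 - S.indicator 1
  have ha : h =ᵐ[a] 1 := by
    filter_upwards [measure_eq_zero_iff_ae_notMem.1 haS] with x hx
    simp [h, hx]
  have hb : h =ᵐ[b] -1 := by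
    filter_upwards [measure_eq_zero_iff_ae_notMem.1 hbS] with x hx
    simp only [Set.mem_compl_iff, not_not] at hx
    simp [h, hx]
  have hhm : Integrable h (a + b) :=
    ((integrable_const (1 : ℝ)).indicator hS.compl).sub ((integrable_const (1 : ℝ)).indicator hS)
  have h0 := ae_eq_zero_of_integral_contDiff_smul_eq_zero hhm.locallyIntegrable
    (fun g hg hgs ↦ by
      have hga : (fun x ↦ g x • h x) =ᵐ[a] g := by
        filter_upwards [ha] with x hx
        simp [hx]
      have hgb : (fun x ↦ g x • h x) =ᵐ[b] -g := by
        filter_upwards [hb] with x hx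
        simp [hx]
      rw [integral_add_measure ((hint g hg hgs a).congr hga.symm)
        ((hint g hg hgs b).neg.congr hgb.symm), integral_congr_ae hga, integral_congr_ae hgb]
      simp [integral_neg, key g hg hgs])
  rw [ae_add_measure_iff] at h0
  have ha0 : a = 0 := by
    rw [← ae_eq_bot, ← eventually_false_iff_eq_bot]
    filter_upwards [ha, h0.1] with x h1 h2
    simp [h2] at h1
  have hb0 : b = 0 := by
    rw [← ae_eq_bot, ← eventually_false_iff_eq_bot]
    filter_upwards [hb, h0.2] with x h1 h2
    simp [h2] at h1
  rw [hsab]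
  ext A hA
  simp [ha0, hb0]

/-- The total variation norm `‖T‖_𝓜` on `𝓜(K)`, extended by `∞` to all distributions that are
not a bounded measure supported in `K`. (The infimum runs over at most one measure.) -/
def measureNorm (T : PlaneDistribution) : ℝ≥0∞ :=
  ⨅ (μ : SignedMeasure (ℝ × ℝ)) (_ : SupportedInSquare μ) (_ : IsMeasure T μ),
    μ.totalVariation Set.univ

theorem measureNorm_eq {T : PlaneDistribution} {μ : SignedMeasure (ℝ × ℝ)}
    (hK : SupportedInSquare μ) (hμ : IsMeasure T μ) :
    measureNorm T = μ.totalVariation Set.univ :=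
  le_antisymm (iInf_le_of_le μ (iInf_le_of_le hK (iInf_le _ hμ)))
    (le_iInf fun _ ↦ le_iInf fun _ ↦ le_iInf fun hν ↦ by rw [hμ.unique hν])

/-- The partial derivative `[D ⊗ I]{f} = ∂₁ f` of a distribution. -/
def dxI (f : PlaneDistribution) : PlaneDistribution := ∂_{((1, 0) : ℝ × ℝ)} f

/-- The partial derivative `[I ⊗ D]{f} = ∂₂ f` of a distribution. -/
def iXd (f : PlaneDistribution) : PlaneDistribution := ∂_{((0, 1) : ℝ × ℝ)} f

/-- The mixed derivative `[D ⊗ D]{f} = ∂₁ ∂₂ f` of a distribution. -/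
def mixedDeriv (f : PlaneDistribution) : PlaneDistribution := dxI (iXd f)

/-- The (anisotropic) gradient norm `‖∇f‖ = ‖[I ⊗ D]f‖_𝓜 + ‖[D ⊗ I]f‖_𝓜`. -/
def gradNorm (f : PlaneDistribution) : ℝ≥0∞ := measureNorm (iXd f) + measureNorm (dxI f)

/-- The native space: distributions `f` on the plane that vanish outside `K` and whose mixed
derivative is a bounded measure supported in `K`. -/
def NativeSpace : Type :=
  {f : PlaneDistribution //
    (∃ m : SignedMeasure (ℝ × ℝ), SupportedInSquare m ∧ IsMeasure (mixedDeriv f) m) ∧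
    ∀ φ : 𝓓((⊤ : Opens (ℝ × ℝ)), ℝ), tsupport φ ⊆ unitSquareᶜ → f φ = 0}

namespace NativeSpace

/-- The underlying distribution. -/
def toDistribution (f : NativeSpace) : PlaneDistribution := f.1

/-- The measure `m = [D ⊗ D]{f}` (it is unique by `IsMeasure.unique`). -/
def mixedMeasure (f : NativeSpace) : SignedMeasure (ℝ × ℝ) := f.2.1.choose

theorem mixedMeasure_supported (f : NativeSpace) : SupportedInSquare f.mixedMeasure :=
  f.2.1.choose_spec.1

theorem isMeasure_mixedMeasure (f : NativeSpace) :
    IsMeasure (mixedDeriv f.toDistribution) f.mixedMeasure :=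
  f.2.1.choose_spec.2

/-- The norm `‖[D ⊗ D]{f}‖_𝓜`. -/
def mixedNorm (f : NativeSpace) : ℝ≥0∞ := measureNorm (mixedDeriv f.toDistribution)

/-- The pairing `⟨f, [D ⊗ D]{φ}⟩` for `φ ∈ C₀(ℝ²)`, i.e. the extension of
`φ ↦ ⟨f, [D ⊗ D]{φ}⟩ = ⟨[D ⊗ D]{f}, φ⟩` from test functions `φ` to `C₀(ℝ²)` by continuity for
the sup norm. -/
def pairing (f : NativeSpace) (φ : C₀(ℝ × ℝ, ℝ)) : ℝ := ∫ᵛ x, φ x ∂<•f.mixedMeasure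

/-- On test functions, `pairing` is the pairing `⟨f, ∂₁ ∂₂ φ⟩` of distributions. -/
theorem pairing_eq (f : NativeSpace) (φ : 𝓓((⊤ : Opens (ℝ × ℝ)), ℝ)) (ψ : C₀(ℝ × ℝ, ℝ))
    (h : ∀ x, ψ x = φ x) :
    f.pairing ψ =
      f.toDistribution (∂_{((0, 1) : ℝ × ℝ)} (∂_{((1, 0) : ℝ × ℝ)} φ)) := by
  have h1 := f.isMeasure_mixedMeasure φ
  simp only [mixedDeriv, dxI, iXd, Distribution.lineDerivOp_apply_apply, LineDeriv.lineDerivOp_neg,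
    neg_neg] at h1
  rw [h1, pairing, funext h]

/-- Weak* convergence: convergence of the pairing with every element `[D ⊗ D]{φ}`,
`φ ∈ C₀(ℝ²)`, of the predual. -/
def WeakStarTendsto (F : ℕ → NativeSpace) (f : NativeSpace) : Prop :=
  ∀ φ : C₀(ℝ × ℝ, ℝ), Tendsto (fun n ↦ (F n).pairing φ) atTop (𝓝 (f.pairing φ))

end NativeSpace

/-- The distribution `T` is the integrable function `g`. -/
def IsL1Function (T : PlaneDistribution) (g : ℝ × ℝ → ℝ) : Prop :=
  Integrable g ∧ ∀ φ : 𝓓((⊤ : Opens (ℝ × ℝ)), ℝ), T φ = ∫ x, φ x * g x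

/-- The distributions `F n`, `n ≥ 1`, and `f` are integrable functions, and `F n → f` in
`L¹(K)`. -/
def L1Tendsto (F : ℕ → PlaneDistribution) (f : PlaneDistribution) : Prop :=
  ∃ (G : ℕ → ℝ × ℝ → ℝ) (g : ℝ × ℝ → ℝ),
    (∀ n, 1 ≤ n → IsL1Function (F n) (G n)) ∧ IsL1Function f g ∧
    Tendsto (fun n ↦ ∫ x in unitSquare, |G n x - g x|) atTop (𝓝 0)

/-- `μ` is a discrete measure supported on the grid `(1/n){1,…,n} × (1/n){1,…,n}`. -/
def IsGridMeasure (n : ℕ) (μ : SignedMeasure (ℝ × ℝ)) : Prop :=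
  ∃ a : ℕ → ℕ → ℝ, μ = ∑ k ∈ Finset.Icc 1 n, ∑ l ∈ Finset.Icc 1 n,
    VectorMeasure.dirac ((k : ℝ) / n, (l : ℝ) / n) (a k l)

end MixedTV

end

open MeasureTheory TopologicalSpace Filter
open scoped Distributions LineDeriv Topology ENNReal ZeroAtInfty

noncomputable section

namespace MixedTV

/-! Write the mixed derivative of `f` as `a - b`, with finite positive measures `a`, `b` on `K`.
Since `f` vanishes off `K` and `∂₁∂₂` kills functions of one coordinate, `a - b` integrates every
such smooth function to `0`, so `a` and `b` have equal marginals (`NativeSpace.balanced`).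
Conversely, for such a pair `cdf a - cdf b` vanishes off `K` and has mixed derivative `a - b`; `f`
equals this function (`NativeSpace.toDistribution_eq_cdfDist`).

The approximants push `a` and `b` forward under `gridMap n`, which moves each point to the upper
right corner of its grid cell. As a product map it keeps the marginals equal, so the result is again
the mixed derivative of an element of the native space. A pushforward does not increase total
variation, and weak* convergence is dominated convergence. Moving mass up and right lowers each
`cdf`, so the `L¹` error is at most an integral without absolute value, which equals the integral of
`(1 - x)(1 - y)` against `a - quantize n a`, plus the same for `b`.

For the gradient, `∂₁ f` is `a - b` smeared upwards. Quantizing first and smearing afterwards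
differs from smearing first and rounding the abscissa by a mass of order `1/n`. Rounding is a
pushforward, so the limsup of the norms is at most the norm of the limit; lower semicontinuity
(`tendsto_measureNorm`) gives the other inequality. -/

/-- Test functions on the plane. -/
abbrev PlaneTest : Type := 𝓓((⊤ : Opens (ℝ × ℝ)), ℝ)

/-! ### Total variation by duality -/

/-- The signed measure `a - b`. -/
abbrev diff {X : Type*} [MeasurableSpace X] (a b : Measure X) [IsFiniteMeasure a]
    [IsFiniteMeasure b] : SignedMeasure X :=
  a.toSignedMeasure - b.toSignedMeasure

instance isFiniteMeasure_totalVariation {X : Type*} [MeasurableSpace X] (μ : SignedMeasure X) :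
    IsFiniteMeasure μ.totalVariation := by
  unfold SignedMeasure.totalVariation
  infer_instance

theorem integral_diff {X : Type*} [MeasurableSpace X] {a b : Measure X} [IsFiniteMeasure a]
    [IsFiniteMeasure b] {ψ : X → ℝ} (ha : Integrable ψ a) (hb : Integrable ψ b) :
    ∫ᵛ x, ψ x ∂<•diff a b = ∫ x, ψ x ∂a - ∫ x, ψ x ∂b := by
  rw [VectorMeasure.integral_sub_vectorMeasure
      (by simpa [VectorMeasure.Integrable] using ha)
      (by simpa [VectorMeasure.Integrable] using hb),
    VectorMeasure.integral_toSignedMeasure, VectorMeasure.integral_toSignedMeasure]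

theorem integrable_of_measurable_of_bound {X : Type*} [MeasurableSpace X] {a : Measure X}
    [IsFiniteMeasure a] {ψ : X → ℝ} (hψ : Measurable ψ) {C : ℝ} (hC : ∀ x, |ψ x| ≤ C) :
    Integrable ψ a :=
  .of_bound hψ.aestronglyMeasurable C (.of_forall hC)

theorem integrable_testFunction (φ : PlaneTest) (a : Measure (ℝ × ℝ))
    [IsFiniteMeasureOnCompacts a] : Integrable φ a :=
  φ.continuous.integrable_of_hasCompactSupport φ.hasCompactSupport

theorem isMeasure_diff_iff {T : PlaneDistribution} {a b : Measure (ℝ × ℝ)} [IsFiniteMeasure a]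
    [IsFiniteMeasure b] :
    IsMeasure T (diff a b) ↔ ∀ φ : PlaneTest, T φ = ∫ x, φ x ∂a - ∫ x, φ x ∂b :=
  forall_congr' fun φ ↦ by
    rw [integral_diff (integrable_testFunction φ a) (integrable_testFunction φ b)]

theorem supportedInSquare_diff {a b : Measure (ℝ × ℝ)} [IsFiniteMeasure a] [IsFiniteMeasure b]
    (ha : a unitSquareᶜ = 0) (hb : b unitSquareᶜ = 0) : SupportedInSquare (diff a b) := by
  intro A hA hAK
  simp [hA, Measure.real, measure_mono_null hAK ha, measure_mono_null hAK hb]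

/-- Measurability of `ψ` is all that is asked, because test functions composed with the
discontinuous grid maps will be inserted. -/
theorem integral_diff_le_totalVariation {X : Type*} [MeasurableSpace X] {a b : Measure X}
    [IsFiniteMeasure a] [IsFiniteMeasure b] {ψ : X → ℝ} (hψ : Measurable ψ)
    (h1 : ∀ x, |ψ x| ≤ 1) :
    ∫ x, ψ x ∂a - ∫ x, ψ x ∂b ≤ (diff a b).totalVariation.real Set.univ := by
  have : IsFiniteMeasure (diff a b).variation := by
    rw [← SignedMeasure.totalVariation_eq_variation]
    infer_instance
  rw [← integral_diff (integrable_of_measurable_of_bound hψ h1)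
    (integrable_of_measurable_of_bound hψ h1), SignedMeasure.totalVariation_eq_variation]
  refine (le_abs_self _).trans ?_
  have h : ‖∫ᵛ x, ψ x ∂<•diff a b‖ₑ ≤ (diff a b).variation Set.univ := by
    refine VectorMeasure.enorm_integral_le_lintegral_enorm_transpose.trans ?_
    rw [VectorMeasure.variation_transpose_lsmul_flip]
    refine (lintegral_mono (g := fun _ ↦ 1) fun x ↦ ?_).trans (by simp)
    rw [← ofReal_norm, Real.norm_eq_abs]
    exact ENNReal.ofReal_le_one.2 (h1 x)
  have := ENNReal.toReal_mono (by finiteness) h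
  rwa [toReal_enorm, Real.norm_eq_abs] at this

/-- A cutoff function that is `1` on a given ball. -/
theorem exists_cutoff (R : ℝ) : ∃ χ : ℝ × ℝ → ℝ, ContDiff ℝ (⊤ : ℕ∞) χ ∧ HasCompactSupport χ ∧
    (∀ x, χ x ∈ Set.Icc 0 1) ∧ ∀ x ∈ Metric.closedBall (0 : ℝ × ℝ) R, χ x = 1 := by
  let β : ContDiffBump (0 : ℝ × ℝ) :=
    ⟨max R 1, max R 1 + 1, lt_max_of_lt_right one_pos, by linarith⟩
  exact ⟨β, β.contDiff, β.hasCompactSupport, fun x ↦ ⟨β.nonneg, β.le_one⟩, fun x hx ↦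
    β.one_of_mem_closedBall (Metric.closedBall_subset_closedBall (le_max_left _ _) hx)⟩

theorem exists_testFunction_one_neg_one {A B : Set (ℝ × ℝ)} (hA : IsCompact A)
    (hB : IsCompact B) (hAB : Disjoint A B) :
    ∃ φ : PlaneTest, (∀ x, |φ x| ≤ 1) ∧ (∀ x ∈ A, φ x = 1) ∧ ∀ x ∈ B, φ x = -1 := by
  obtain ⟨g, hg, hgr, hgB, hgA⟩ := exists_contMDiff_zero_iff_one_iff_of_isClosed
    (n := (⊤ : ℕ∞)) (modelWithCornersSelf ℝ (ℝ × ℝ)) hB.isClosed hA.isClosed hAB.symm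
  obtain ⟨R, hR⟩ := (hA.union hB).isBounded.subset_closedBall 0
  obtain ⟨χ, hχ, hχc, hχ01, hχ1⟩ := exists_cutoff R
  refine ⟨⟨fun x ↦ χ x * (2 * g x - 1), hχ.mul ((contDiff_const.mul hg.contDiff).sub
    contDiff_const), hχc.mul_right, by simp⟩, fun x ↦ ?_, fun x hx ↦ ?_, fun x hx ↦ ?_⟩
  · have h1 := hχ01 x
    have h2 := hgr ⟨x, rfl⟩
    change |χ x * (2 * g x - 1)| ≤ 1
    rw [abs_mul, abs_of_nonneg h1.1]
    exact mul_le_one₀ h1.2 (abs_nonneg _) (abs_le.2 ⟨by linarith [h2.1], by linarith [h2.2]⟩)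
  · change χ x * (2 * g x - 1) = 1
    rw [hχ1 x (hR (.inl hx)), (hgA x).1 hx]
    norm_num
  · change χ x * (2 * g x - 1) = -1
    rw [hχ1 x (hR (.inr hx)), (hgB x).1 hx]
    norm_num

/-- Pointwise, `ψ ≥ 1 - 2 · 1_{Aᶜ}`. -/
theorem integral_ge_of_eq_one {X : Type*} [MeasurableSpace X] {a : Measure X} [IsFiniteMeasure a]
    {ψ : X → ℝ} (hψ : Measurable ψ) (h1 : ∀ x, |ψ x| ≤ 1) {A : Set X} (hA : MeasurableSet A)
    (hA1 : ∀ x ∈ A, ψ x = 1) :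
    a.real Set.univ - 2 * a.real Aᶜ ≤ ∫ x, ψ x ∂a := by
  have h : ∫ x, (1 - 2 * Aᶜ.indicator (fun _ ↦ (1 : ℝ)) x) ∂a ≤ ∫ x, ψ x ∂a := by
    refine integral_mono ((integrable_const _).sub
      (((integrable_const (1 : ℝ)).indicator hA.compl).const_mul 2))
      (integrable_of_measurable_of_bound hψ h1) fun x ↦ ?_
    by_cases hx : x ∈ A
    · simp [hx, hA1 x hx]
    · have := (abs_le.1 (h1 x)).1
      simp only [Set.mem_compl_iff, hx, not_false_eq_true, Set.indicator_of_mem]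
      linarith
  refine le_trans (le_of_eq ?_) h
  rw [integral_sub (integrable_const _)
    (((integrable_const (1 : ℝ)).indicator hA.compl).const_mul 2), integral_const_mul,
    integral_indicator hA.compl]
  simp

/-- The total variation is the supremum of the integrals of test functions bounded by `1`. -/
theorem totalVariation_le_of_forall_testFunction (μ : SignedMeasure (ℝ × ℝ)) {c : ℝ≥0∞}
    (h : ∀ φ : PlaneTest, (∀ x, |φ x| ≤ 1) → ENNReal.ofReal (∫ᵛ x, φ x ∂<•μ) ≤ c) :
    μ.totalVariation Set.univ ≤ c := by
  set a := μ.toJordanDecomposition.posPart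
  set b := μ.toJordanDecomposition.negPart
  have hμ : μ = diff a b := μ.toSignedMeasure_toJordanDecomposition.symm
  obtain ⟨S, hS, haS, hbS⟩ := μ.toJordanDecomposition.mutuallySingular
  refine ENNReal.le_of_forall_pos_le_add fun ε hε _ ↦ ?_
  have hε4 : ENNReal.ofReal (ε / 4) ≠ 0 := by simpa using hε
  -- Inner regularity: `A` and `B` are disjoint compact sets missing mass at most `ε / 4` of `a` and
  -- `b`. Each missing mass is counted twice, which gives a total loss of `ε`.
  obtain ⟨A, hAS, hA, haA⟩ := hS.compl.exists_isCompact_lt_add (measure_ne_top a _) hε4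
  obtain ⟨B, hBS, hB, hbB⟩ := hS.exists_isCompact_lt_add (measure_ne_top b _) hε4
  obtain ⟨φ, hφ1, hφA, hφB⟩ := exists_testFunction_one_neg_one hA hB
    (Set.disjoint_left.2 fun x h1 h2 ↦ hAS h1 (hBS h2))
  have key (κ : Measure (ℝ × ℝ)) [IsFiniteMeasure κ] (V W : Set (ℝ × ℝ)) (hV : MeasurableSet V)
      (hW : MeasurableSet W) (hκ : κ Wᶜ = 0) (hlt : κ W < κ V + ENNReal.ofReal (ε / 4)) :
      κ.real Vᶜ ≤ ε / 4 := by
    have h1 : κ W = κ Set.univ := by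
      rw [← measure_add_measure_compl hW, hκ, add_zero]
    have h2 : κ.real Set.univ ≤ κ.real V + ε / 4 := by
      rw [h1] at hlt
      have := ENNReal.toReal_mono (by finiteness) hlt.le
      rwa [ENNReal.toReal_add (by finiteness) (by finiteness),
        ENNReal.toReal_ofReal (by positivity)] at this
    rw [measureReal_compl hV]
    linarith
  have ha := key a A Sᶜ hA.measurableSet hS.compl (by rwa [compl_compl]) haA
  have hb := key b B S hB.measurableSet hS hbS hbB
  have ha' := integral_ge_of_eq_one (a := a) φ.continuous.measurable hφ1 hA.measurableSet hφA
  have hb' := integral_ge_of_eq_one (a := b) (ψ := fun x ↦ -φ x) φ.continuous.measurable.neg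
    (by simpa using hφ1) hB.measurableSet (fun x hx ↦ by rw [hφB x hx, neg_neg])
  rw [integral_neg] at hb'
  have h3 := h φ hφ1
  rw [hμ, integral_diff (integrable_testFunction φ a) (integrable_testFunction φ b)] at h3
  calc μ.totalVariation Set.univ = a Set.univ + b Set.univ := rfl
    _ = ENNReal.ofReal (a.real Set.univ + b.real Set.univ) := by
      rw [ENNReal.ofReal_add measureReal_nonneg measureReal_nonneg]
      simp
    _ ≤ ENNReal.ofReal ((∫ x, φ x ∂a - ∫ x, φ x ∂b) + ε) := by
      exact ENNReal.ofReal_le_ofReal (by linarith)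
    _ ≤ ENNReal.ofReal (∫ x, φ x ∂a - ∫ x, φ x ∂b) + ENNReal.ofReal ε := ENNReal.ofReal_add_le
    _ ≤ c + ε := by
      gcongr
      simp

theorem measureNorm_le_of_forall {T : PlaneDistribution} {μ : SignedMeasure (ℝ × ℝ)}
    (hK : SupportedInSquare μ) (hμ : IsMeasure T μ) {c : ℝ≥0∞}
    (h : ∀ φ : PlaneTest, (∀ x, |φ x| ≤ 1) → ENNReal.ofReal (T φ) ≤ c) : measureNorm T ≤ c := by
  rw [measureNorm_eq hK hμ]
  exact totalVariation_le_of_forall_testFunction μ fun φ hφ ↦ hμ φ ▸ h φ hφ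

theorem measureNorm_lt_top {T : PlaneDistribution} {μ : SignedMeasure (ℝ × ℝ)}
    (hK : SupportedInSquare μ) (hμ : IsMeasure T μ) : measureNorm T < ∞ := by
  rw [measureNorm_eq hK hμ]
  exact measure_lt_top _ _

theorem ofReal_integral_diff_le_measureNorm {T : PlaneDistribution} {a b : Measure (ℝ × ℝ)}
    [IsFiniteMeasure a] [IsFiniteMeasure b] (hK : SupportedInSquare (diff a b))
    (hμ : IsMeasure T (diff a b)) {ψ : ℝ × ℝ → ℝ} (hψ : Measurable ψ) (h1 : ∀ x, |ψ x| ≤ 1) :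
    ENNReal.ofReal (∫ x, ψ x ∂a - ∫ x, ψ x ∂b) ≤ measureNorm T := by
  rw [measureNorm_eq hK hμ]
  refine (ENNReal.ofReal_le_ofReal (integral_diff_le_totalVariation hψ h1)).trans ?_
  simp

/-- If `T n → T` pointwise on test functions and the norms satisfy `‖T n‖ ≤ ‖T‖ + ε n` with
`ε n → 0`, then `‖T n‖ → ‖T‖`, by lower semicontinuity of the total variation. -/
theorem tendsto_measureNorm {T : PlaneDistribution} {μ : SignedMeasure (ℝ × ℝ)}
    (hK : SupportedInSquare μ) (hμ : IsMeasure T μ) {S : ℕ → PlaneDistribution}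
    {a b : ℕ → Measure (ℝ × ℝ)} [∀ n, IsFiniteMeasure (a n)] [∀ n, IsFiniteMeasure (b n)]
    (hSK : ∀ n, SupportedInSquare (diff (a n) (b n)))
    (hS : ∀ n, IsMeasure (S n) (diff (a n) (b n)))
    (hlim : ∀ φ : PlaneTest, Tendsto (fun n ↦ S n φ) atTop (𝓝 (T φ))) {ε : ℕ → ℝ≥0∞}
    (hε : Tendsto ε atTop (𝓝 0))
    (hle : ∀ᶠ n in atTop, measureNorm (S n) ≤ measureNorm T + ε n) :
    Tendsto (fun n ↦ measureNorm (S n)) atTop (𝓝 (measureNorm T)) := by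
  refine tendsto_of_le_liminf_of_limsup_le ?_ ?_
  · refine measureNorm_le_of_forall hK hμ fun φ hφ ↦ ?_
    rw [← ((ENNReal.continuous_ofReal.tendsto _).comp (hlim φ)).liminf_eq]
    refine liminf_le_liminf (.of_forall fun n ↦ ?_)
    have := ofReal_integral_diff_le_measureNorm (hSK n) (hS n) φ.continuous.measurable hφ
    rwa [← isMeasure_diff_iff.1 (hS n) φ] at this
  · have h := (hε.const_add (measureNorm T)).limsup_eq
    rw [add_zero] at h
    exact (limsup_le_limsup hle).trans h.le

/-! ### Distribution functions and quadrant integrals -/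

/-- The distribution function of a measure on the plane. -/
def cdf (a : Measure (ℝ × ℝ)) (z : ℝ × ℝ) : ℝ := a.real (Set.Iic z)

/-- The integral of `φ` over the quadrant with lower left corner `w`. -/
def quadInt (φ : ℝ × ℝ → ℝ) (w : ℝ × ℝ) : ℝ := ∫ z in Set.Ici w, φ z

theorem measurableSet_snd_le_fst :
    MeasurableSet {p : (ℝ × ℝ) × (ℝ × ℝ) | p.2 ≤ p.1} :=
  measurableSet_le measurable_snd measurable_fst

theorem measurable_cdf (a : Measure (ℝ × ℝ)) [IsFiniteMeasure a] : Measurable (cdf a) :=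
  (measurable_measure_prodMk_left (ν := a) measurableSet_snd_le_fst).ennreal_toReal

theorem integrable_quadrant_kernel {φ : ℝ × ℝ → ℝ} (hφ : Integrable φ) (a : Measure (ℝ × ℝ))
    [IsFiniteMeasure a] :
    Integrable ({p : (ℝ × ℝ) × (ℝ × ℝ) | p.2 ≤ p.1}.indicator fun p ↦ φ p.1)
      (volume.prod a) :=
  (hφ.comp_fst a).indicator measurableSet_snd_le_fst

theorem integral_quadrant_kernel_snd (φ : ℝ × ℝ → ℝ) (a : Measure (ℝ × ℝ)) (z : ℝ × ℝ) :
    ∫ w, {p : (ℝ × ℝ) × (ℝ × ℝ) | p.2 ≤ p.1}.indicator (fun p ↦ φ p.1) (z, w) ∂a =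
      φ z * cdf a z := by
  have : (fun w ↦ {p : (ℝ × ℝ) × (ℝ × ℝ) | p.2 ≤ p.1}.indicator (fun p ↦ φ p.1) (z, w)) =
      (Set.Iic z).indicator fun _ ↦ φ z := by
    ext w
    simp [Set.indicator]
  rw [this, integral_indicator measurableSet_Iic]
  simp [cdf, mul_comm]

theorem integral_quadrant_kernel_fst (φ : ℝ × ℝ → ℝ) (w : ℝ × ℝ) :
    ∫ z, {p : (ℝ × ℝ) × (ℝ × ℝ) | p.2 ≤ p.1}.indicator (fun p ↦ φ p.1) (z, w) =
      quadInt φ w := by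
  have : (fun z ↦ {p : (ℝ × ℝ) × (ℝ × ℝ) | p.2 ≤ p.1}.indicator (fun p ↦ φ p.1) (z, w)) =
      (Set.Ici w).indicator φ := by
    ext z
    simp [Set.indicator]
  rw [this, integral_indicator measurableSet_Ici]
  rfl

theorem integrable_mul_cdf {φ : ℝ × ℝ → ℝ} (hφ : Integrable φ) (a : Measure (ℝ × ℝ))
    [IsFiniteMeasure a] : Integrable fun z ↦ φ z * cdf a z := by
  simpa only [integral_quadrant_kernel_snd] using
    (integrable_quadrant_kernel hφ a).integral_prod_left

theorem integrable_quadInt {φ : ℝ × ℝ → ℝ} (hφ : Integrable φ) (a : Measure (ℝ × ℝ))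
    [IsFiniteMeasure a] : Integrable (quadInt φ) a := by
  have := (integrable_quadrant_kernel hφ a).integral_prod_right
  simp only [integral_quadrant_kernel_fst] at this
  exact this

/-- Fubini: testing the distribution function amounts to integrating quadrant integrals. -/
theorem integral_mul_cdf {φ : ℝ × ℝ → ℝ} (hφ : Integrable φ) (a : Measure (ℝ × ℝ))
    [IsFiniteMeasure a] : ∫ z, φ z * cdf a z = ∫ w, quadInt φ w ∂a := by
  simp only [← integral_quadrant_kernel_snd, ← integral_quadrant_kernel_fst]
  exact integral_integral_swap (integrable_quadrant_kernel hφ a)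

/-! ### Quadrant integrals and partial derivatives -/

theorem lineDeriv_fst (g : ℝ × ℝ → ℝ) (x y : ℝ) :
    lineDeriv ℝ g (x, y) (1, 0) = deriv (fun u ↦ g (u, y)) x := by
  simpa [lineDeriv] using deriv_comp_const_add (f := fun u ↦ g (u, y)) x 0

theorem lineDeriv_snd (g : ℝ × ℝ → ℝ) (x y : ℝ) :
    lineDeriv ℝ g (x, y) (0, 1) = deriv (fun u ↦ g (x, u)) y := by
  simpa [lineDeriv] using deriv_comp_const_add (f := fun u ↦ g (x, u)) y 0

theorem testFunction_lineDeriv_apply (φ : PlaneTest) (v z : ℝ × ℝ) :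
    (∂_{v} φ : PlaneTest) z = lineDeriv ℝ φ z v :=
  TestFunction.lineDerivCLM_apply_of_le (by simp)

theorem hasCompactSupport_slice_fst {φ : ℝ × ℝ → ℝ} (hφ : HasCompactSupport φ) (y : ℝ) :
    HasCompactSupport fun x ↦ φ (x, y) :=
  .intro (hφ.isCompact.image continuous_fst) fun _ hx ↦
    image_eq_zero_of_notMem_tsupport fun h ↦ hx ⟨_, h, rfl⟩

theorem hasCompactSupport_slice_snd {φ : ℝ × ℝ → ℝ} (hφ : HasCompactSupport φ) (x : ℝ) :
    HasCompactSupport fun y ↦ φ (x, y) :=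
  .intro (hφ.isCompact.image continuous_snd) fun _ hx ↦
    image_eq_zero_of_notMem_tsupport fun h ↦ hx ⟨_, h, rfl⟩

theorem quadInt_eq_iterated {φ : ℝ × ℝ → ℝ} (hφ : Integrable φ) (w : ℝ × ℝ) :
    quadInt φ w = ∫ x in Set.Ici w.1, ∫ y in Set.Ici w.2, φ (x, y) := by
  rw [quadInt, show Set.Ici w = Set.Ici w.1 ×ˢ Set.Ici w.2 from (Set.Ici_prod_eq w)]
  exact setIntegral_prod _ hφ.integrableOn

theorem quadInt_eq_iterated_symm {φ : ℝ × ℝ → ℝ} (hφ : Integrable φ) (w : ℝ × ℝ) :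
    quadInt φ w = ∫ y in Set.Ici w.2, ∫ x in Set.Ici w.1, φ (x, y) := by
  rw [quadInt, show Set.Ici w = Set.Ici w.1 ×ˢ Set.Ici w.2 from (Set.Ici_prod_eq w)]
  rw [Measure.volume_eq_prod, ← Measure.prod_restrict]
  refine integral_prod_symm _ ?_
  rw [Measure.prod_restrict]
  exact hφ.integrableOn

/-- Integrating along the direction of differentiation first, the fundamental theorem of calculus
leaves only the boundary ray. -/
theorem quadInt_lineDeriv_fst (φ : PlaneTest) (w : ℝ × ℝ) :
    quadInt (∂_{((1, 0) : ℝ × ℝ)} φ : PlaneTest) w = -∫ y in Set.Ici w.2, φ (w.1, y) := by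
  rw [quadInt_eq_iterated_symm (integrable_testFunction _ _), ← integral_neg]
  refine integral_congr_ae (.of_forall fun y ↦ ?_)
  simp only [testFunction_lineDeriv_apply, lineDeriv_fst, integral_Ici_eq_integral_Ioi]
  exact HasCompactSupport.integral_Ioi_deriv_eq
    ((φ.contDiff.of_le (by exact_mod_cast le_top)).comp (contDiff_id.prodMk contDiff_const))
    (hasCompactSupport_slice_fst φ.hasCompactSupport y) _

theorem quadInt_lineDeriv_snd (φ : PlaneTest) (w : ℝ × ℝ) :
    quadInt (∂_{((0, 1) : ℝ × ℝ)} φ : PlaneTest) w = -∫ x in Set.Ici w.1, φ (x, w.2) := by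
  rw [quadInt_eq_iterated (integrable_testFunction _ _), ← integral_neg]
  refine integral_congr_ae (.of_forall fun x ↦ ?_)
  simp only [testFunction_lineDeriv_apply, lineDeriv_snd, integral_Ici_eq_integral_Ioi]
  exact HasCompactSupport.integral_Ioi_deriv_eq
    ((φ.contDiff.of_le (by exact_mod_cast le_top)).comp (contDiff_const.prodMk contDiff_id))
    (hasCompactSupport_slice_snd φ.hasCompactSupport x) _

/-- This is why `cdf a` has mixed derivative `a`: `quadInt` inverts `∂₁∂₂` on test functions, and it
is the adjoint of `cdf`. -/
theorem quadInt_mixed (φ : PlaneTest) (w : ℝ × ℝ) :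
    quadInt (∂_{((0, 1) : ℝ × ℝ)} (∂_{((1, 0) : ℝ × ℝ)} φ : PlaneTest) : PlaneTest) w = φ w := by
  rw [quadInt_lineDeriv_snd]
  simp only [testFunction_lineDeriv_apply, lineDeriv_fst, integral_Ici_eq_integral_Ioi]
  exact neg_eq_iff_eq_neg.2 (HasCompactSupport.integral_Ioi_deriv_eq
    ((φ.contDiff.of_le (by exact_mod_cast le_top)).comp (contDiff_id.prodMk contDiff_const))
    (hasCompactSupport_slice_fst φ.hasCompactSupport w.2) _)

/-- As a convolution with a locally integrable kernel, `quadInt φ` inherits smoothness from `φ` and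
commutes with derivatives. -/
theorem quadInt_eq_convolution (φ : ℝ × ℝ → ℝ) :
    quadInt φ = convolution ((Set.Iic (0 : ℝ × ℝ)).indicator fun _ ↦ (1 : ℝ)) φ
      (ContinuousLinearMap.mul ℝ ℝ) volume := by
  ext w
  rw [quadInt, convolution, ← integral_indicator measurableSet_Ici,
    ← integral_sub_left_eq_self _ volume w]
  refine integral_congr_ae (.of_forall fun u ↦ ?_)
  by_cases h : u ≤ 0 <;> simp [Set.indicator, h]

theorem locallyIntegrable_indicator_Iic :
    LocallyIntegrable ((Set.Iic (0 : ℝ × ℝ)).indicator fun _ ↦ (1 : ℝ)) :=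
  (locallyIntegrable_const 1).indicator measurableSet_Iic

theorem contDiff_quadInt (φ : PlaneTest) : ContDiff ℝ (⊤ : ℕ∞) (quadInt φ) := by
  rw [quadInt_eq_convolution]
  exact φ.hasCompactSupport.contDiff_convolution_right _ locallyIntegrable_indicator_Iic
    φ.contDiff

theorem lineDeriv_quadInt (φ : PlaneTest) (v w : ℝ × ℝ) :
    lineDeriv ℝ (quadInt φ) w v = quadInt (∂_{v} φ : PlaneTest) w := by
  have h1 : ContDiff ℝ 1 φ := φ.contDiff.of_le (by exact_mod_cast le_top)
  have h := φ.hasCompactSupport.hasFDerivAt_convolution_right (μ := volume)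
    (ContinuousLinearMap.mul ℝ ℝ) locallyIntegrable_indicator_Iic h1 w
  rw [← quadInt_eq_convolution] at h
  rw [(h.hasLineDerivAt v).lineDeriv, quadInt_eq_convolution,
    convolution_precompR_apply _ locallyIntegrable_indicator_Iic
      (φ.hasCompactSupport.fderiv ℝ) (h1.continuous_fderiv one_ne_zero)]
  congr 1

/-! ### Balanced pairs and their native-space elements -/

/-- The distribution given by the function `cdf a - cdf b`. -/
def cdfDist (a b : Measure (ℝ × ℝ)) : PlaneDistribution where
  toFun := TestFunction.integralAgainstBilinCLM (ContinuousLinearMap.mul ℝ ℝ) volume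
    fun z ↦ cdf a z - cdf b z
  map_add' := map_add _
  map_smul' := map_smul _
  cont := ContinuousLinearMap.continuous _

/-- Two finite measures on the unit square with the same marginals. -/
structure Balanced (a b : Measure (ℝ × ℝ)) : Prop where
  left : a unitSquareᶜ = 0
  right : b unitSquareᶜ = 0
  fst : a.map Prod.fst = b.map Prod.fst
  snd : a.map Prod.snd = b.map Prod.snd

theorem measurableSet_unitSquare : MeasurableSet unitSquare :=
  measurableSet_Icc.prod measurableSet_Icc

theorem isCompact_unitSquare : IsCompact unitSquare := isCompact_Icc.prod isCompact_Icc

theorem ae_mem_unitSquare {a : Measure (ℝ × ℝ)} (ha : a unitSquareᶜ = 0) :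
    ∀ᵐ w ∂a, w ∈ unitSquare :=
  mem_ae_iff.2 ha

theorem cdf_eq_zero {a : Measure (ℝ × ℝ)} (ha : a unitSquareᶜ = 0) {z : ℝ × ℝ}
    (hz : z.1 < 0 ∨ z.2 < 0) : cdf a z = 0 := by
  have : a (Set.Iic z) = 0 := measure_mono_null (t := unitSquareᶜ) (fun w hw hK ↦ by
    have h1 := hw.1
    have h2 := hw.2
    have h3 := hK.1.1
    have h4 := hK.2.1
    rcases hz with h | h <;> linarith) ha
  simp [cdf, Measure.real, this]

/-- To the right of the square the first coordinate imposes no constraint, so only a marginal is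
seen. -/
theorem cdf_eq_map_snd {a : Measure (ℝ × ℝ)} (ha : a unitSquareᶜ = 0) {z : ℝ × ℝ}
    (hz : 1 < z.1) : cdf a z = (a.map Prod.snd).real (Set.Iic z.2) := by
  rw [cdf, map_measureReal_apply measurable_snd measurableSet_Iic]
  refine measureReal_congr ?_
  filter_upwards [ae_mem_unitSquare ha] with w hw
  exact propext ⟨fun h ↦ h.2, fun h ↦ ⟨hw.1.2.trans hz.le, h⟩⟩

theorem cdf_eq_map_fst {a : Measure (ℝ × ℝ)} (ha : a unitSquareᶜ = 0) {z : ℝ × ℝ}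
    (hz : 1 < z.2) : cdf a z = (a.map Prod.fst).real (Set.Iic z.1) := by
  rw [cdf, map_measureReal_apply measurable_fst measurableSet_Iic]
  refine measureReal_congr ?_
  filter_upwards [ae_mem_unitSquare ha] with w hw
  exact propext ⟨fun h ↦ h.1, fun h ↦ ⟨h, hw.2.2.trans hz.le⟩⟩

theorem Balanced.cdf_sub_eq_zero {a b : Measure (ℝ × ℝ)} (h : Balanced a b) {z : ℝ × ℝ}
    (hz : z ∉ unitSquare) : cdf a z - cdf b z = 0 := by
  rw [sub_eq_zero]
  by_cases h0 : z.1 < 0 ∨ z.2 < 0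
  · rw [cdf_eq_zero h.left h0, cdf_eq_zero h.right h0]
  push Not at h0
  by_cases h1 : 1 < z.1
  · rw [cdf_eq_map_snd h.left h1, cdf_eq_map_snd h.right h1, h.snd]
  by_cases h2 : 1 < z.2
  · rw [cdf_eq_map_fst h.left h2, cdf_eq_map_fst h.right h2, h.fst]
  exact absurd ⟨⟨h0.1, not_lt.1 h1⟩, h0.2, not_lt.1 h2⟩ hz

theorem Balanced.integrable_cdf_sub {a b : Measure (ℝ × ℝ)} [IsFiniteMeasure a]
    [IsFiniteMeasure b] (h : Balanced a b) : Integrable fun z ↦ cdf a z - cdf b z := by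
  have hm := (measurable_cdf a).sub (measurable_cdf b)
  rw [← integrableOn_iff_integrable_of_support_subset (s := unitSquare)
    (Function.support_subset_iff'.2 fun z hz ↦ h.cdf_sub_eq_zero hz)]
  refine Measure.integrableOn_of_bounded (M := a.real Set.univ + b.real Set.univ)
    isCompact_unitSquare.measure_lt_top.ne hm.aestronglyMeasurable (.of_forall fun z ↦ ?_)
  have h1 : 0 ≤ cdf a z := measureReal_nonneg
  have h2 : 0 ≤ cdf b z := measureReal_nonneg
  have h3 : cdf a z ≤ a.real Set.univ := measureReal_mono (Set.subset_univ _)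
  have h4 : cdf b z ≤ b.real Set.univ := measureReal_mono (Set.subset_univ _)
  exact abs_le.2 ⟨by linarith, by linarith⟩

theorem Balanced.cdfDist_apply {a b : Measure (ℝ × ℝ)} [IsFiniteMeasure a] [IsFiniteMeasure b]
    (h : Balanced a b) (φ : PlaneTest) :
    cdfDist a b φ = ∫ z, φ z * (cdf a z - cdf b z) :=
  TestFunction.integralAgainstBilinCLM_eq_integral
    (h.integrable_cdf_sub.locallyIntegrable.locallyIntegrableOn _)

theorem Balanced.cdfDist_apply_quadInt {a b : Measure (ℝ × ℝ)} [IsFiniteMeasure a]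
    [IsFiniteMeasure b] (h : Balanced a b) (φ : PlaneTest) :
    cdfDist a b φ = ∫ w, quadInt φ w ∂a - ∫ w, quadInt φ w ∂b := by
  have hφ := integrable_testFunction φ volume
  rw [h.cdfDist_apply, ← integral_mul_cdf hφ, ← integral_mul_cdf hφ,
    ← integral_sub (integrable_mul_cdf hφ a) (integrable_mul_cdf hφ b)]
  simp only [mul_sub]

theorem dxI_apply (T : PlaneDistribution) (φ : PlaneTest) :
    dxI T φ = -T (∂_{((1, 0) : ℝ × ℝ)} φ : PlaneTest) := by
  rw [dxI, Distribution.lineDerivOp_apply_apply, map_neg]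

theorem iXd_apply (T : PlaneDistribution) (φ : PlaneTest) :
    iXd T φ = -T (∂_{((0, 1) : ℝ × ℝ)} φ : PlaneTest) := by
  rw [iXd, Distribution.lineDerivOp_apply_apply, map_neg]

theorem mixedDeriv_apply (T : PlaneDistribution) (φ : PlaneTest) :
    mixedDeriv T φ =
      T (∂_{((0, 1) : ℝ × ℝ)} (∂_{((1, 0) : ℝ × ℝ)} φ : PlaneTest) : PlaneTest) := by
  rw [mixedDeriv, dxI_apply, iXd_apply, neg_neg]

theorem Balanced.isMeasure_mixedDeriv {a b : Measure (ℝ × ℝ)} [IsFiniteMeasure a]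
    [IsFiniteMeasure b] (h : Balanced a b) : IsMeasure (mixedDeriv (cdfDist a b)) (diff a b) := by
  refine isMeasure_diff_iff.2 fun φ ↦ ?_
  rw [mixedDeriv_apply, h.cdfDist_apply_quadInt]
  simp only [quadInt_mixed]

/-- The element of the native space whose mixed derivative is `a - b`. -/
def Balanced.toNative {a b : Measure (ℝ × ℝ)} [IsFiniteMeasure a]
    [IsFiniteMeasure b] (h : Balanced a b) : NativeSpace :=
  ⟨cdfDist a b, ⟨diff a b, supportedInSquare_diff h.left h.right, h.isMeasure_mixedDeriv⟩,
    fun φ hφ ↦ by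
      rw [h.cdfDist_apply]
      refine integral_eq_zero_of_ae (.of_forall fun z ↦ ?_)
      change φ z * (cdf a z - cdf b z) = 0
      by_cases hz : z ∈ unitSquare
      · rw [image_eq_zero_of_notMem_tsupport fun h' ↦ hφ h' hz]
        simp
      · rw [h.cdf_sub_eq_zero hz]
        simp⟩

theorem Balanced.mixedMeasure_toNative {a b : Measure (ℝ × ℝ)} [IsFiniteMeasure a]
    [IsFiniteMeasure b] (h : Balanced a b) : h.toNative.mixedMeasure = diff a b :=
  h.toNative.isMeasure_mixedMeasure.unique h.isMeasure_mixedDeriv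

theorem Balanced.isL1Function {a b : Measure (ℝ × ℝ)} [IsFiniteMeasure a]
    [IsFiniteMeasure b] (h : Balanced a b) :
    IsL1Function (cdfDist a b) fun z ↦ cdf a z - cdf b z :=
  ⟨h.integrable_cdf_sub, h.cdfDist_apply⟩

/-! ### First partial derivatives as measures -/

/-- The measure on the square that smears each point of `a` upwards to the top edge. -/
def edgeFst (a : Measure (ℝ × ℝ)) : Measure (ℝ × ℝ) :=
  ((a.prod (volume.restrict (Set.Icc (0 : ℝ) 1))).restrict {p | p.1.2 ≤ p.2}).map
    fun p ↦ (p.1.1, p.2)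

/-- The measure on the square that smears each point of `a` rightwards to the right edge. -/
def edgeSnd (a : Measure (ℝ × ℝ)) : Measure (ℝ × ℝ) :=
  (edgeFst (a.map Prod.swap)).map Prod.swap

instance (a : Measure (ℝ × ℝ)) [IsFiniteMeasure a] : IsFiniteMeasure (edgeFst a) := by
  unfold edgeFst
  infer_instance

instance (a : Measure (ℝ × ℝ)) [IsFiniteMeasure a] : IsFiniteMeasure (edgeSnd a) := by
  unfold edgeSnd
  infer_instance

theorem integral_edgeFst {a : Measure (ℝ × ℝ)} [IsFiniteMeasure a] (ha : a unitSquareᶜ = 0)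
    {ψ : ℝ × ℝ → ℝ} (hψ : Measurable ψ) {C : ℝ} (hC : ∀ x, |ψ x| ≤ C) :
    ∫ z, ψ z ∂edgeFst a = ∫ w, (∫ y in Set.Icc w.2 1, ψ (w.1, y)) ∂a := by
  have hm : Measurable fun p : (ℝ × ℝ) × ℝ ↦ (p.1.1, p.2) := by fun_prop
  have hs : MeasurableSet {p : (ℝ × ℝ) × ℝ | p.1.2 ≤ p.2} :=
    measurableSet_le (by fun_prop) (by fun_prop)
  have hi : Integrable ({p : (ℝ × ℝ) × ℝ | p.1.2 ≤ p.2}.indicator fun p ↦ ψ (p.1.1, p.2))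
      (a.prod (volume.restrict (Set.Icc (0 : ℝ) 1))) :=
    (integrable_of_measurable_of_bound (hψ.comp hm) fun p ↦ hC (p.1.1, p.2)).indicator hs
  rw [edgeFst, integral_map hm.aemeasurable hψ.aestronglyMeasurable, ← integral_indicator hs,
    integral_prod _ hi]
  refine integral_congr_ae ?_
  filter_upwards [ae_mem_unitSquare ha] with w hw
  have : (fun y ↦ {p : (ℝ × ℝ) × ℝ | p.1.2 ≤ p.2}.indicator (fun p ↦ ψ (p.1.1, p.2)) (w, y)) =
      (Set.Ici w.2).indicator fun y ↦ ψ (w.1, y) := by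
    ext y
    simp [Set.indicator]
  rw [this, setIntegral_indicator measurableSet_Ici]
  -- Since `w` lies in the square, `0 ≤ w.2`, so cutting `[0, 1]` at height `w.2` gives `[w.2, 1]`.
  congr 2
  ext y
  simp only [Set.mem_inter_iff, Set.mem_Icc, Set.mem_Ici]
  exact ⟨fun h ↦ ⟨h.2, h.1.2⟩, fun h ↦ ⟨⟨hw.2.1.trans h.1, h.2⟩, h.1⟩⟩

theorem map_swap_compl_unitSquare {a : Measure (ℝ × ℝ)} (ha : a unitSquareᶜ = 0) :
    a.map Prod.swap unitSquareᶜ = 0 := by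
  rw [Measure.map_apply measurable_swap measurableSet_unitSquare.compl]
  exact measure_mono_null (t := unitSquareᶜ) (fun w hw hK ↦ hw ⟨hK.2, hK.1⟩) ha

theorem integral_edgeSnd {a : Measure (ℝ × ℝ)} [IsFiniteMeasure a] (ha : a unitSquareᶜ = 0)
    {ψ : ℝ × ℝ → ℝ} (hψ : Measurable ψ) {C : ℝ} (hC : ∀ x, |ψ x| ≤ C) :
    ∫ z, ψ z ∂edgeSnd a = ∫ w, (∫ x in Set.Icc w.1 1, ψ (x, w.2)) ∂a := by
  rw [edgeSnd, integral_map measurable_swap.aemeasurable hψ.aestronglyMeasurable,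
    integral_edgeFst (ψ := fun x ↦ ψ x.swap) (map_swap_compl_unitSquare ha) (hψ.comp measurable_swap)
      (fun x ↦ hC x.swap)]
  exact MeasurableEmbedding.integral_map
    (MeasurableEquiv.prodComm (α := ℝ) (β := ℝ)).measurableEmbedding _

theorem edgeFst_compl_unitSquare {a : Measure (ℝ × ℝ)} [IsFiniteMeasure a]
    (ha : a unitSquareᶜ = 0) : edgeFst a unitSquareᶜ = 0 := by
  have hm : Measurable fun p : (ℝ × ℝ) × ℝ ↦ (p.1.1, p.2) := by fun_prop
  rw [edgeFst, Measure.map_apply hm measurableSet_unitSquare.compl]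
  refine le_antisymm ((Measure.restrict_apply_le _ _).trans ?_) bot_le
  refine (measure_mono (t := unitSquareᶜ ×ˢ Set.univ ∪ Set.univ ×ˢ (Set.Icc 0 1)ᶜ) ?_).trans
    ((measure_union_le _ _).trans (by simp [ha]))
  rintro ⟨w, y⟩ h
  by_cases hw : w ∈ unitSquare
  · exact .inr ⟨trivial, fun hy ↦ h ⟨hw.1, hy⟩⟩
  · exact .inl ⟨hw, trivial⟩

theorem edgeSnd_compl_unitSquare {a : Measure (ℝ × ℝ)} [IsFiniteMeasure a]
    (ha : a unitSquareᶜ = 0) : edgeSnd a unitSquareᶜ = 0 :=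
  map_swap_compl_unitSquare (edgeFst_compl_unitSquare (map_swap_compl_unitSquare ha))

theorem exists_bound_testFunction (φ : PlaneTest) : ∃ C, ∀ x, |φ x| ≤ C :=
  φ.hasCompactSupport.exists_bound_of_continuous φ.continuous

theorem integral_Ici_eq_add {h : ℝ → ℝ} (hh : Integrable h) {t : ℝ} (ht : t ≤ 1) :
    ∫ y in Set.Ici t, h y = (∫ y in Set.Icc t 1, h y) + ∫ y in Set.Ioi 1, h y := by
  rw [← setIntegral_union _ measurableSet_Ioi hh.integrableOn hh.integrableOn,
    Set.Icc_union_Ioi_eq_Ici ht]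
  exact Set.disjoint_left.2 fun x hx hx' ↦ not_lt.2 hx.2 hx'

theorem integrable_slice_snd (φ : PlaneTest) (x : ℝ) : Integrable fun y ↦ φ (x, y) :=
  (φ.continuous.comp (by fun_prop : Continuous fun y : ℝ ↦ (x, y))).integrable_of_hasCompactSupport
    (hasCompactSupport_slice_snd φ.hasCompactSupport x)

theorem integrable_slice_fst (φ : PlaneTest) (y : ℝ) : Integrable fun x ↦ φ (x, y) :=
  (φ.continuous.comp (by fun_prop : Continuous fun x : ℝ ↦ (x, y))).integrable_of_hasCompactSupport
    (hasCompactSupport_slice_fst φ.hasCompactSupport y)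

theorem abs_quadInt_le {φ : ℝ × ℝ → ℝ} (hφ : Integrable φ) (w : ℝ × ℝ) :
    |quadInt φ w| ≤ ∫ z, |φ z| :=
  (norm_integral_le_integral_norm _).trans
    (setIntegral_le_integral hφ.norm (.of_forall fun _ ↦ norm_nonneg _))

/-- `quadInt (∂₁ φ) w` is minus the integral of `φ` over the whole vertical ray above `w`. Its part
above height `1` depends on `w.1` only; it becomes the marginal term, which cancels between the two
measures of a balanced pair. -/
theorem integral_edgeFst_testFunction {a : Measure (ℝ × ℝ)} [IsFiniteMeasure a]
    (ha : a unitSquareᶜ = 0) (φ : PlaneTest) :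
    ∫ z, φ z ∂edgeFst a = -∫ w, quadInt (∂_{((1, 0) : ℝ × ℝ)} φ : PlaneTest) w ∂a +
      ∫ s, quadInt (∂_{((1, 0) : ℝ × ℝ)} φ : PlaneTest) (s, 1) ∂(a.map Prod.fst) := by
  obtain ⟨C, hC⟩ := exists_bound_testFunction φ
  have hi := integrable_testFunction (∂_{((1, 0) : ℝ × ℝ)} φ : PlaneTest) volume
  have hc : Continuous fun s : ℝ ↦ quadInt (∂_{((1, 0) : ℝ × ℝ)} φ : PlaneTest) (s, 1) :=
    (contDiff_quadInt _).continuous.comp (by fun_prop)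
  rw [integral_edgeFst ha φ.continuous.measurable hC,
    integral_map measurable_fst.aemeasurable hc.aestronglyMeasurable, ← integral_neg]
  refine Eq.trans (integral_congr_ae ?_) (integral_add (integrable_quadInt hi a).neg
    (integrable_of_measurable_of_bound (hc.measurable.comp measurable_fst)
      fun x ↦ abs_quadInt_le hi _))
  filter_upwards [ae_mem_unitSquare ha] with w hw
  rw [quadInt_lineDeriv_fst, quadInt_lineDeriv_fst,
    integral_Ici_eq_add (integrable_slice_snd φ w.1) hw.2.2,
    integral_Ici_eq_add (integrable_slice_snd φ w.1) le_rfl]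
  simp

theorem integral_edgeSnd_testFunction {a : Measure (ℝ × ℝ)} [IsFiniteMeasure a]
    (ha : a unitSquareᶜ = 0) (φ : PlaneTest) :
    ∫ z, φ z ∂edgeSnd a = -∫ w, quadInt (∂_{((0, 1) : ℝ × ℝ)} φ : PlaneTest) w ∂a +
      ∫ t, quadInt (∂_{((0, 1) : ℝ × ℝ)} φ : PlaneTest) (1, t) ∂(a.map Prod.snd) := by
  obtain ⟨C, hC⟩ := exists_bound_testFunction φ
  have hi := integrable_testFunction (∂_{((0, 1) : ℝ × ℝ)} φ : PlaneTest) volume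
  have hc : Continuous fun t : ℝ ↦ quadInt (∂_{((0, 1) : ℝ × ℝ)} φ : PlaneTest) (1, t) :=
    (contDiff_quadInt _).continuous.comp (by fun_prop)
  rw [integral_edgeSnd ha φ.continuous.measurable hC,
    integral_map measurable_snd.aemeasurable hc.aestronglyMeasurable, ← integral_neg]
  refine Eq.trans (integral_congr_ae ?_) (integral_add (integrable_quadInt hi a).neg
    (integrable_of_measurable_of_bound (hc.measurable.comp measurable_snd)
      fun x ↦ abs_quadInt_le hi _))
  filter_upwards [ae_mem_unitSquare ha] with w hw
  rw [quadInt_lineDeriv_snd, quadInt_lineDeriv_snd,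
    integral_Ici_eq_add (integrable_slice_fst φ w.2) hw.1.2,
    integral_Ici_eq_add (integrable_slice_fst φ w.2) le_rfl]
  simp

theorem Balanced.isMeasure_dxI {a b : Measure (ℝ × ℝ)} [IsFiniteMeasure a] [IsFiniteMeasure b]
    (h : Balanced a b) : IsMeasure (dxI (cdfDist a b)) (diff (edgeFst a) (edgeFst b)) := by
  refine isMeasure_diff_iff.2 fun φ ↦ ?_
  rw [dxI_apply, h.cdfDist_apply_quadInt, integral_edgeFst_testFunction h.left,
    integral_edgeFst_testFunction h.right, h.fst]
  ring

theorem Balanced.isMeasure_iXd {a b : Measure (ℝ × ℝ)} [IsFiniteMeasure a] [IsFiniteMeasure b]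
    (h : Balanced a b) : IsMeasure (iXd (cdfDist a b)) (diff (edgeSnd a) (edgeSnd b)) := by
  refine isMeasure_diff_iff.2 fun φ ↦ ?_
  rw [iXd_apply, h.cdfDist_apply_quadInt, integral_edgeSnd_testFunction h.left,
    integral_edgeSnd_testFunction h.right, h.snd]
  ring

/-! ### Structure of the native space -/

theorem unitSquare_subset_ball : unitSquare ⊆ Metric.ball (0 : ℝ × ℝ) 2 := by
  rintro ⟨x, y⟩ ⟨⟨h1, h2⟩, h3, h4⟩
  simp only [mem_ball_zero_iff, Prod.norm_def, Real.norm_eq_abs, sup_lt_iff]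
  simp only at h1 h2 h3 h4
  constructor <;> rw [abs_of_nonneg] <;> linarith

/-- The native space pairing with a smooth function `Ψ` that need not have compact support. -/
theorem NativeSpace.apply_eq_integral (f : NativeSpace) {a b : Measure (ℝ × ℝ)}
    [IsFiniteMeasure a] [IsFiniteMeasure b] (ha : a unitSquareᶜ = 0) (hb : b unitSquareᶜ = 0)
    (hf : f.mixedMeasure = diff a b) {Ψ : ℝ × ℝ → ℝ} (hΨ : ContDiff ℝ (⊤ : ℕ∞) Ψ)
    (φ : PlaneTest)
    (h : ∀ w, lineDeriv ℝ (fun z ↦ lineDeriv ℝ Ψ z (1, 0)) w (0, 1) = φ w) :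
    f.toDistribution φ = ∫ w, Ψ w ∂a - ∫ w, Ψ w ∂b := by
  obtain ⟨χ, hχ, hχc, -, hχ1⟩ := exists_cutoff 2
  let ψ : PlaneTest := ⟨fun x ↦ χ x * Ψ x, hχ.mul hΨ, hχc.mul_right, by simp⟩
  have hψ : ∀ x ∈ Metric.ball (0 : ℝ × ℝ) 2, ψ x = Ψ x := fun x hx ↦ by
    change χ x * Ψ x = Ψ x
    rw [hχ1 x (Metric.ball_subset_closedBall hx), one_mul]
  have h1 : ∀ x ∈ Metric.ball (0 : ℝ × ℝ) 2,
      (∂_{((1, 0) : ℝ × ℝ)} ψ : PlaneTest) x = lineDeriv ℝ Ψ x (1, 0) := fun x hx ↦ by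
    rw [testFunction_lineDeriv_apply]
    exact Filter.EventuallyEq.lineDeriv_eq
      (Filter.mem_of_superset (Metric.isOpen_ball.mem_nhds hx) hψ)
  have h2 : ∀ x ∈ Metric.ball (0 : ℝ × ℝ) 2,
      (∂_{((0, 1) : ℝ × ℝ)} (∂_{((1, 0) : ℝ × ℝ)} ψ : PlaneTest) : PlaneTest) x = φ x :=
    fun x hx ↦ by
      rw [testFunction_lineDeriv_apply, ← h]
      exact Filter.EventuallyEq.lineDeriv_eq
        (Filter.mem_of_superset (Metric.isOpen_ball.mem_nhds hx) h1)
  -- The difference vanishes on an open ball containing the square, so its closed support avoids the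
  -- square and `f` annihilates it.
  have h3 := f.2.2
    (φ - (∂_{((0, 1) : ℝ × ℝ)} (∂_{((1, 0) : ℝ × ℝ)} ψ : PlaneTest) : PlaneTest)) (by
      refine Set.Subset.trans (closure_minimal (t := (Metric.ball (0 : ℝ × ℝ) 2)ᶜ) ?_
        Metric.isOpen_ball.isClosed_compl) (Set.compl_subset_compl.2 unitSquare_subset_ball)
      exact fun x hx hx' ↦ hx (sub_eq_zero.2 (h2 x hx').symm))
  rw [map_sub, sub_eq_zero] at h3
  have h4 := isMeasure_diff_iff.1 (hf ▸ f.isMeasure_mixedMeasure) ψ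
  rw [mixedDeriv_apply] at h4
  refine h3.trans (h4.trans ?_)
  congr 1
  · refine integral_congr_ae ?_
    filter_upwards [ae_mem_unitSquare ha] with w hw using hψ w (unitSquare_subset_ball hw)
  · refine integral_congr_ae ?_
    filter_upwards [ae_mem_unitSquare hb] with w hw using hψ w (unitSquare_subset_ball hw)

/-- Testing with `cos (t x)` and `sin (t x)` recovers the characteristic function. -/
theorem measure_ext_of_integral_contDiff {μ ν : Measure ℝ} [IsFiniteMeasure μ]
    [IsFiniteMeasure ν]
    (h : ∀ η : ℝ → ℝ, ContDiff ℝ (⊤ : ℕ∞) η → ∫ x, η x ∂μ = ∫ x, η x ∂ν) : μ = ν := by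
  refine Measure.ext_of_charFun (funext fun t ↦ ?_)
  have key (κ : Measure ℝ) [IsFiniteMeasure κ] : charFun κ t =
      (∫ x, Real.cos (t * x) ∂κ : ℝ) + (∫ x, Real.sin (t * x) ∂κ : ℝ) * Complex.I := by
    have hc : Integrable (fun x ↦ Real.cos (t * x)) κ :=
      integrable_of_measurable_of_bound (by fun_prop) fun x ↦ Real.abs_cos_le_one _
    have hs : Integrable (fun x ↦ Real.sin (t * x)) κ :=
      integrable_of_measurable_of_bound (by fun_prop) fun x ↦ Real.abs_sin_le_one _
    rw [charFun_apply_real, ← integral_complex_ofReal, ← integral_complex_ofReal, ← integral_mul_const,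
      ← integral_add hc.ofReal (hs.ofReal.mul_const _)]
    refine integral_congr_ae (.of_forall fun x ↦ ?_)
    simp only [Complex.ofReal_cos, Complex.ofReal_sin, Complex.ofReal_mul, Complex.exp_mul_I]
  rw [key, key, h _ (by fun_prop), h _ (by fun_prop)]

/-- A smooth function of one coordinate has zero mixed derivative, so its integrals against `a` and
`b` agree. -/
theorem NativeSpace.balanced (f : NativeSpace) {a b : Measure (ℝ × ℝ)}
    [IsFiniteMeasure a] [IsFiniteMeasure b] (ha : a unitSquareᶜ = 0) (hb : b unitSquareᶜ = 0)
    (hf : f.mixedMeasure = diff a b) : Balanced a b := by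
  refine ⟨ha, hb, measure_ext_of_integral_contDiff fun η hη ↦ ?_,
    measure_ext_of_integral_contDiff fun η hη ↦ ?_⟩
  · have h := f.apply_eq_integral ha hb hf (hη.comp contDiff_fst) 0 (fun w ↦ by
      obtain ⟨x, y⟩ := w
      rw [lineDeriv_snd]
      simp only [lineDeriv_fst]
      simp)
    rw [map_zero, eq_comm, sub_eq_zero] at h
    rwa [integral_map measurable_fst.aemeasurable hη.continuous.aestronglyMeasurable,
      integral_map measurable_fst.aemeasurable hη.continuous.aestronglyMeasurable]
  · have h := f.apply_eq_integral ha hb hf (hη.comp contDiff_snd) 0 (fun w ↦ by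
      obtain ⟨x, y⟩ := w
      rw [lineDeriv_snd]
      simp only [lineDeriv_fst]
      simp)
    rw [map_zero, eq_comm, sub_eq_zero] at h
    rwa [integral_map measurable_snd.aemeasurable hη.continuous.aestronglyMeasurable,
      integral_map measurable_snd.aemeasurable hη.continuous.aestronglyMeasurable]

/-- An element of the native space is the distribution function of its mixed derivative. -/
theorem NativeSpace.toDistribution_eq_cdfDist (f : NativeSpace) {a b : Measure (ℝ × ℝ)}
    [IsFiniteMeasure a] [IsFiniteMeasure b] (ha : a unitSquareᶜ = 0) (hb : b unitSquareᶜ = 0)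
    (hf : f.mixedMeasure = diff a b) : f.toDistribution = cdfDist a b := by
  refine DFunLike.ext _ _ fun φ ↦ ?_
  rw [(f.balanced ha hb hf).cdfDist_apply_quadInt]
  -- `quadInt φ` is a smooth solution of `∂₂∂₁ Ψ = φ`; its support need not be compact.
  refine f.apply_eq_integral ha hb hf (contDiff_quadInt φ) φ fun w ↦ ?_
  simp only [lineDeriv_quadInt]
  exact quadInt_mixed φ w

theorem exists_diff_eq {μ : SignedMeasure (ℝ × ℝ)} (hμ : SupportedInSquare μ) :
    ∃ (a b : Measure (ℝ × ℝ)) (_ : IsFiniteMeasure a) (_ : IsFiniteMeasure b),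
      a unitSquareᶜ = 0 ∧ b unitSquareᶜ = 0 ∧ μ = diff a b := by
  obtain ⟨S, hS, haS, hbS⟩ := μ.toJordanDecomposition.mutuallySingular
  have hd : μ = diff μ.toJordanDecomposition.posPart μ.toJordanDecomposition.negPart :=
    μ.toSignedMeasure_toJordanDecomposition.symm
  have hK := measurableSet_unitSquare.compl
  refine ⟨_, _, inferInstance, inferInstance, ?_, ?_, hd⟩
  -- On `Sᶜ` the negative part is null, so there `μ` is the positive part, which therefore has no
  -- mass outside the square; on `S` the positive part is null. The second bullet is symmetric.
  · have h1 := hμ _ (hK.inter hS.compl) Set.inter_subset_left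
    rw [hd, sub_apply, Measure.toSignedMeasure_apply_measurable (hK.inter hS.compl),
      Measure.toSignedMeasure_apply_measurable (hK.inter hS.compl), sub_eq_zero, Measure.real,
      Measure.real, measure_mono_null Set.inter_subset_right hbS, ENNReal.toReal_zero,
      ENNReal.toReal_eq_zero_iff, or_iff_left (measure_ne_top _ _)] at h1
    rw [← measure_inter_add_sdiff _ hS.compl, h1, zero_add]
    exact measure_mono_null (fun x hx ↦ not_not.1 hx.2) haS
  · have h1 := hμ _ (hK.inter hS) Set.inter_subset_left
    rw [hd, sub_apply, Measure.toSignedMeasure_apply_measurable (hK.inter hS),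
      Measure.toSignedMeasure_apply_measurable (hK.inter hS), sub_eq_zero, Measure.real,
      Measure.real, measure_mono_null Set.inter_subset_right haS, ENNReal.toReal_zero, eq_comm,
      ENNReal.toReal_eq_zero_iff, or_iff_left (measure_ne_top _ _)] at h1
    rw [← measure_inter_add_sdiff _ hS, h1, zero_add]
    exact measure_mono_null (fun x hx ↦ hx.2) hbS

/-! ### Quantization on the grid -/

/-- The index of the grid cell of side `1/n` that contains `x`. -/
def gridIdx (n : ℕ) (x : ℝ) : ℕ := min n (max 1 ⌈n * x⌉₊)

/-- The right end of the grid cell of side `1/n` that contains `x`. -/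
def gridPt (n : ℕ) (x : ℝ) : ℝ := gridIdx n x / n

/-- The upper right corner of the grid square of side `1/n` that contains `w`. -/
def gridMap (n : ℕ) : ℝ × ℝ → ℝ × ℝ := Prod.map (gridPt n) (gridPt n)

/-- The image of a measure on the grid. -/
def quantize (n : ℕ) (a : Measure (ℝ × ℝ)) : Measure (ℝ × ℝ) := a.map (gridMap n)

theorem measurable_gridIdx (n : ℕ) : Measurable (gridIdx n) :=
  (measurable_of_countable fun k : ℕ ↦ min n (max 1 k)).comp
    (Nat.measurable_ceil.comp (measurable_const_mul _))

theorem measurable_gridPt (n : ℕ) : Measurable (gridPt n) :=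
  ((measurable_of_countable fun k : ℕ ↦ (k : ℝ)).comp (measurable_gridIdx n)).div_const _

theorem measurable_gridMap (n : ℕ) : Measurable (gridMap n) :=
  (measurable_gridPt n).prodMap (measurable_gridPt n)

/-- True also for `n = 0`, where the quotient is `0`; hence the approximants are defined for every
natural index. -/
theorem gridPt_mem_Icc (n : ℕ) (x : ℝ) : gridPt n x ∈ Set.Icc 0 1 :=
  ⟨by unfold gridPt; positivity,
    div_le_one_of_le₀ (by exact_mod_cast min_le_left _ _) (Nat.cast_nonneg _)⟩

theorem gridMap_mem_unitSquare (n : ℕ) (w : ℝ × ℝ) : gridMap n w ∈ unitSquare :=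
  ⟨gridPt_mem_Icc n w.1, gridPt_mem_Icc n w.2⟩

/-- The clamp `max 1` matters at `x = 0`, whose ceiling is `0`: that point joins the first cell. -/
theorem gridIdx_mem_Icc {n : ℕ} (hn : 1 ≤ n) (x : ℝ) : gridIdx n x ∈ Finset.Icc 1 n :=
  Finset.mem_Icc.2 ⟨le_min hn (le_max_left _ _), min_le_left _ _⟩

theorem le_gridPt {n : ℕ} (hn : 1 ≤ n) {x : ℝ} (hx : x ≤ 1) : x ≤ gridPt n x := by
  have hn0 : (0 : ℝ) < n := by exact_mod_cast hn
  rw [gridPt, le_div_iff₀ hn0, gridIdx, Nat.cast_min, Nat.cast_max]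
  refine le_min (by nlinarith) (le_max_of_le_right ?_)
  rw [mul_comm]
  exact Nat.le_ceil _

theorem gridPt_le_add {n : ℕ} (hn : 1 ≤ n) {x : ℝ} (hx : 0 ≤ x) : gridPt n x ≤ x + 1 / n := by
  have hn0 : (0 : ℝ) < n := by exact_mod_cast hn
  have h : ((gridIdx n x : ℕ) : ℝ) ≤ n * x + 1 := by
    rw [gridIdx, Nat.cast_min, Nat.cast_max]
    refine (min_le_right _ _).trans (max_le ?_ (Nat.ceil_lt_add_one (by positivity)).le)
    push_cast
    nlinarith
  rw [gridPt, div_le_iff₀ hn0]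
  field_simp
  linarith

theorem tendsto_gridPt {x : ℝ} (hx : x ∈ Set.Icc (0 : ℝ) 1) :
    Tendsto (fun n ↦ gridPt n x) atTop (𝓝 x) := by
  have h : Tendsto (fun n : ℕ ↦ x + 1 / (n : ℝ)) atTop (𝓝 x) := by
    simpa using tendsto_one_div_atTop_nhds_zero_nat.const_add x
  refine tendsto_of_tendsto_of_tendsto_of_le_of_le' tendsto_const_nhds h ?_ ?_
  · filter_upwards [eventually_ge_atTop 1] with n hn using le_gridPt hn hx.2
  · filter_upwards [eventually_ge_atTop 1] with n hn using gridPt_le_add hn hx.1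

instance (n : ℕ) (a : Measure (ℝ × ℝ)) [IsFiniteMeasure a] : IsFiniteMeasure (quantize n a) := by
  unfold quantize
  infer_instance

theorem quantize_compl_unitSquare (n : ℕ) (a : Measure (ℝ × ℝ)) :
    quantize n a unitSquareᶜ = 0 := by
  rw [quantize, Measure.map_apply (measurable_gridMap n) measurableSet_unitSquare.compl]
  exact measure_mono_null (t := ∅) (fun w hw ↦ hw (gridMap_mem_unitSquare n w)) measure_empty

theorem map_fst_quantize (n : ℕ) (a : Measure (ℝ × ℝ)) :
    (quantize n a).map Prod.fst = (a.map Prod.fst).map (gridPt n) := by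
  rw [quantize, Measure.map_map measurable_fst (measurable_gridMap n),
    Measure.map_map (measurable_gridPt n) measurable_fst]
  rfl

theorem map_snd_quantize (n : ℕ) (a : Measure (ℝ × ℝ)) :
    (quantize n a).map Prod.snd = (a.map Prod.snd).map (gridPt n) := by
  rw [quantize, Measure.map_map measurable_snd (measurable_gridMap n),
    Measure.map_map (measurable_gridPt n) measurable_snd]
  rfl

theorem map_swap_quantize (n : ℕ) (a : Measure (ℝ × ℝ)) :
    (quantize n a).map Prod.swap = quantize n (a.map Prod.swap) := by
  rw [quantize, quantize, Measure.map_map measurable_swap (measurable_gridMap n),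
    Measure.map_map (measurable_gridMap n) measurable_swap]
  rfl

/-- `gridMap` acts on each coordinate separately, so the new marginals are images of the old ones.
-/
theorem Balanced.quantize {a b : Measure (ℝ × ℝ)} (h : Balanced a b) (n : ℕ) :
    Balanced (quantize n a) (quantize n b) :=
  ⟨quantize_compl_unitSquare n a, quantize_compl_unitSquare n b,
    by rw [map_fst_quantize, map_fst_quantize, h.fst],
    by rw [map_snd_quantize, map_snd_quantize, h.snd]⟩

theorem integral_quantize (n : ℕ) (a : Measure (ℝ × ℝ)) {g : ℝ × ℝ → ℝ} (hg : Measurable g) :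
    ∫ w, g w ∂quantize n a = ∫ w, g (gridMap n w) ∂a :=
  integral_map (measurable_gridMap n).aemeasurable hg.aestronglyMeasurable

/-- Dominated convergence. Continuity suffices, without a global bound, because the quantized points
stay in the compact square. -/
theorem tendsto_integral_quantize {a : Measure (ℝ × ℝ)} [IsFiniteMeasure a]
    (ha : a unitSquareᶜ = 0) {g : ℝ × ℝ → ℝ} (hg : Continuous g) :
    Tendsto (fun n ↦ ∫ w, g w ∂quantize n a) atTop (𝓝 (∫ w, g w ∂a)) := by
  simp only [integral_quantize _ a hg.measurable]
  obtain ⟨C, hC⟩ := isCompact_unitSquare.exists_bound_of_continuousOn hg.continuousOn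
  refine tendsto_integral_of_dominated_convergence (fun _ ↦ C)
    (fun n ↦ (hg.measurable.comp (measurable_gridMap n)).aestronglyMeasurable)
    (integrable_const C) (fun n ↦ .of_forall fun w ↦ hC _ (gridMap_mem_unitSquare n w)) ?_
  filter_upwards [ae_mem_unitSquare ha] with w hw
  exact (hg.tendsto w).comp ((tendsto_gridPt hw.1).prodMk_nhds (tendsto_gridPt hw.2))

theorem measureReal_gridMap_preimage {n : ℕ} (hn : 1 ≤ n) (a : Measure (ℝ × ℝ))
    [IsFiniteMeasure a] (A : Set (ℝ × ℝ)) [DecidablePred (· ∈ A)] :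
    a.real (gridMap n ⁻¹' A) = ∑ k ∈ Finset.Icc 1 n, ∑ l ∈ Finset.Icc 1 n,
      if ((k : ℝ) / n, (l : ℝ) / n) ∈ A then
        a.real (Prod.map (gridIdx n) (gridIdx n) ⁻¹' {(k, l)}) else 0 := by
  rw [← Finset.sum_product', ← Finset.sum_filter, sum_measureReal_preimage_singleton]
  · congr 1
    ext w
    simp only [Set.mem_preimage, Finset.coe_filter, Set.mem_ofPred_eq, Finset.mem_product]
    exact ⟨fun h ↦ ⟨⟨gridIdx_mem_Icc hn _, gridIdx_mem_Icc hn _⟩, h⟩, fun h ↦ h.2⟩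
  · exact fun p _ ↦ ((measurable_gridIdx n).prodMap (measurable_gridIdx n))
      (measurableSet_singleton p)

theorem isGridMeasure_quantize {n : ℕ} (hn : 1 ≤ n) (a b : Measure (ℝ × ℝ)) [IsFiniteMeasure a]
    [IsFiniteMeasure b] : IsGridMeasure n (diff (quantize n a) (quantize n b)) := by
  classical
  -- The weight at a node is the difference of the masses of its cell under `a` and `b`.
  refine ⟨fun k l ↦ a.real (Prod.map (gridIdx n) (gridIdx n) ⁻¹' {(k, l)}) -
    b.real (Prod.map (gridIdx n) (gridIdx n) ⁻¹' {(k, l)}), ?_⟩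
  ext A hA
  rw [sub_apply, Measure.toSignedMeasure_apply_measurable hA,
    Measure.toSignedMeasure_apply_measurable hA, quantize, quantize,
    map_measureReal_apply (measurable_gridMap n) hA,
    map_measureReal_apply (measurable_gridMap n) hA, measureReal_gridMap_preimage hn a,
    measureReal_gridMap_preimage hn b, ← Finset.sum_sub_distrib]
  simp only [← Finset.sum_sub_distrib, sum_apply]
  refine Finset.sum_congr rfl fun k _ ↦ Finset.sum_congr rfl fun l _ ↦ ?_
  by_cases h : ((k : ℝ) / n, (l : ℝ) / n) ∈ A <;> simp [h, hA]

/-! ### Quantization and edge measures -/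

theorem measurable_integral_slice {ψ : ℝ × ℝ → ℝ} (hψ : Measurable ψ) :
    Measurable fun w : ℝ × ℝ ↦ ∫ y in Set.Icc w.2 1, ψ (w.1, y) := by
  have hs : MeasurableSet {p : (ℝ × ℝ) × ℝ | p.2 ∈ Set.Icc p.1.2 1} :=
    (measurableSet_le (f := fun p : (ℝ × ℝ) × ℝ ↦ p.1.2) (g := fun p ↦ p.2)
      (by fun_prop) (by fun_prop)).inter
      (measurableSet_le (f := fun p : (ℝ × ℝ) × ℝ ↦ p.2) (by fun_prop) measurable_const)
  have hm : Measurable fun p : (ℝ × ℝ) × ℝ ↦ ψ (p.1.1, p.2) := hψ.comp (by fun_prop)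
  convert! ((hm.indicator hs).stronglyMeasurable.integral_prod_right' (ν := volume)).measurable
    using 2 with w
  rw [← integral_indicator measurableSet_Icc]
  rfl

theorem abs_setIntegral_le {h : ℝ → ℝ} (h1 : ∀ y, |h y| ≤ 1) {s : Set ℝ} (hs : volume s < ∞) :
    |∫ y in s, h y| ≤ volume.real s := by
  have := norm_setIntegral_le_of_norm_le_const (f := h) (C := 1) hs fun y _ ↦ h1 y
  rwa [one_mul] at this

theorem abs_integral_slice_sub_le {h : ℝ → ℝ} (hm : Measurable h) (h1 : ∀ y, |h y| ≤ 1)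
    {s t : ℝ} (hst : s ≤ t) (ht : t ≤ 1) :
    |(∫ y in Set.Icc t 1, h y) - ∫ y in Set.Icc s 1, h y| ≤ t - s := by
  have hi (s t : ℝ) : IntegrableOn h (Set.Icc s t) :=
    integrable_of_measurable_of_bound hm h1
  have : ∫ y in Set.Icc s 1, h y = (∫ y in Set.Ico s t, h y) + ∫ y in Set.Icc t 1, h y := by
    rw [← setIntegral_union _ measurableSet_Icc ((hi s t).mono_set Set.Ico_subset_Icc_self)
      (hi t 1), Set.Ico_union_Icc_eq_Icc hst ht]
    exact Set.disjoint_left.2 fun x hx hx' ↦ not_le.2 hx.2 hx'.1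
  rw [this, sub_add_cancel_right, abs_neg]
  refine (abs_setIntegral_le h1 (by simp)).trans ?_
  simp [Measure.real, hst]

/-- Both integrals run over vertical segments with the same rounded abscissa. Only the lower
endpoint differs: it is `gridPt n w.2` instead of `w.2`, a shift of at most `1 / n`. -/
theorem abs_integral_edgeFst_quantize_sub_le {n : ℕ} (hn : 1 ≤ n) {a : Measure (ℝ × ℝ)}
    [IsFiniteMeasure a] (ha : a unitSquareᶜ = 0) {ψ : ℝ × ℝ → ℝ} (hψ : Measurable ψ)
    (h1 : ∀ x, |ψ x| ≤ 1) :
    |∫ z, ψ z ∂edgeFst (quantize n a) - ∫ z, ψ (gridPt n z.1, z.2) ∂edgeFst a| ≤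
      1 / n * a.real Set.univ := by
  have hψ' : Measurable fun z : ℝ × ℝ ↦ ψ (gridPt n z.1, z.2) :=
    hψ.comp (((measurable_gridPt n).comp measurable_fst).prodMk measurable_snd)
  have hb {g : ℝ × ℝ → ℝ} (hg : Measurable g) (hg1 : ∀ x, |g x| ≤ 1) (w : ℝ × ℝ)
      (hw : w ∈ unitSquare) : |∫ y in Set.Icc w.2 1, g (w.1, y)| ≤ 1 := by
    refine (abs_setIntegral_le (fun y ↦ hg1 _) (by simp)).trans ?_
    have := hw.2.1
    simp [Measure.real, hw.2.2, this]
  rw [integral_edgeFst (quantize_compl_unitSquare n a) hψ h1,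
    integral_edgeFst ha hψ' (fun x ↦ h1 _),
    integral_quantize n a (measurable_integral_slice hψ), ← integral_sub]
  · rw [← Real.norm_eq_abs]
    refine norm_integral_le_of_norm_le_const ?_
    simp only [Real.norm_eq_abs]
    filter_upwards [ae_mem_unitSquare ha] with w hw
    refine (abs_integral_slice_sub_le (hψ.comp (by fun_prop)) (fun y ↦ h1 _)
      (le_gridPt hn hw.2.2) (gridPt_mem_Icc n w.2).2).trans ?_
    linarith [gridPt_le_add hn hw.2.1]
  · exact .of_bound ((measurable_integral_slice hψ).comp
      (measurable_gridMap n)).aestronglyMeasurable 1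
      (.of_forall fun w ↦ hb hψ h1 _ (gridMap_mem_unitSquare n w))
  · refine .of_bound (measurable_integral_slice hψ').aestronglyMeasurable 1 ?_
    filter_upwards [ae_mem_unitSquare ha] with w hw using hb hψ' (fun _ ↦ h1 _) w hw

theorem abs_integral_edgeSnd_quantize_sub_le {n : ℕ} (hn : 1 ≤ n) {a : Measure (ℝ × ℝ)}
    [IsFiniteMeasure a] (ha : a unitSquareᶜ = 0) {ψ : ℝ × ℝ → ℝ} (hψ : Measurable ψ)
    (h1 : ∀ x, |ψ x| ≤ 1) :
    |∫ z, ψ z ∂edgeSnd (quantize n a) - ∫ z, ψ (z.1, gridPt n z.2) ∂edgeSnd a| ≤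
      1 / n * a.real Set.univ := by
  have hψ' : Measurable fun z : ℝ × ℝ ↦ ψ (z.1, gridPt n z.2) :=
    hψ.comp (measurable_fst.prodMk ((measurable_gridPt n).comp measurable_snd))
  have h := abs_integral_edgeFst_quantize_sub_le hn (map_swap_compl_unitSquare ha)
    (hψ.comp measurable_swap) (fun x ↦ h1 x.swap)
  rw [map_measureReal_apply measurable_swap .univ, Set.preimage_univ] at h
  rw [edgeSnd, edgeSnd, map_swap_quantize,
    integral_map measurable_swap.aemeasurable hψ.aestronglyMeasurable,
    integral_map measurable_swap.aemeasurable hψ'.aestronglyMeasurable]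
  exact h

/-! ### Convergence in `L¹` of the square -/

theorem integrable_indicator_unitSquare :
    Integrable (unitSquare.indicator fun _ : ℝ × ℝ ↦ (1 : ℝ)) :=
  (integrable_indicator_iff measurableSet_unitSquare).2
    (integrableOn_const isCompact_unitSquare.measure_lt_top.ne)

theorem quadInt_indicator_unitSquare {w : ℝ × ℝ} (hw : w ∈ unitSquare) :
    quadInt (unitSquare.indicator fun _ ↦ (1 : ℝ)) w = (1 - w.1) * (1 - w.2) := by
  have h : Set.Ici w ∩ unitSquare = Set.Icc w.1 1 ×ˢ Set.Icc w.2 1 := by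
    ext z
    exact ⟨fun h ↦ ⟨⟨h.1.1, h.2.1.2⟩, h.1.2, h.2.2.2⟩, fun h ↦ ⟨⟨h.1.1, h.2.1⟩,
      ⟨hw.1.1.trans h.1.1, h.1.2⟩, hw.2.1.trans h.2.1, h.2.2⟩⟩
  rw [quadInt, setIntegral_indicator measurableSet_unitSquare, h, setIntegral_const,
    smul_eq_mul, mul_one, Measure.volume_eq_prod, measureReal_prod_prod]
  simp [Measure.real, hw.1.2, hw.2.2]

/-- Fubini: a unit mass at `w` contributes the area of the rectangle between `w` and `(1, 1)`. -/
theorem integral_unitSquare_cdf {a : Measure (ℝ × ℝ)} [IsFiniteMeasure a]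
    (ha : a unitSquareᶜ = 0) :
    ∫ z in unitSquare, cdf a z = ∫ w, (1 - w.1) * (1 - w.2) ∂a := by
  have h := integral_mul_cdf integrable_indicator_unitSquare a
  have h' : (fun z ↦ unitSquare.indicator (fun _ ↦ (1 : ℝ)) z * cdf a z) =
      unitSquare.indicator (cdf a) := by
    ext z
    by_cases hz : z ∈ unitSquare <;> simp [hz]
  rw [h', integral_indicator measurableSet_unitSquare] at h
  rw [h]
  refine integral_congr_ae ?_
  filter_upwards [ae_mem_unitSquare ha] with w hw using quadInt_indicator_unitSquare hw

theorem integrableOn_cdf (a : Measure (ℝ × ℝ)) [IsFiniteMeasure a] :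
    IntegrableOn (cdf a) unitSquare := by
  refine Measure.integrableOn_of_bounded (M := a.real Set.univ)
    isCompact_unitSquare.measure_lt_top.ne (measurable_cdf a).aestronglyMeasurable
    (.of_forall fun z ↦ ?_)
  rw [cdf, Real.norm_of_nonneg measureReal_nonneg]
  exact measureReal_mono (Set.subset_univ _)

/-- Points move only up and right, hence none enters a lower left quadrant. This sign lets the `L¹`
norm be computed as an integral. -/
theorem cdf_quantize_le {n : ℕ} (hn : 1 ≤ n) {a : Measure (ℝ × ℝ)} [IsFiniteMeasure a]
    (ha : a unitSquareᶜ = 0) (z : ℝ × ℝ) : cdf (quantize n a) z ≤ cdf a z := by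
  rw [cdf, cdf, quantize, map_measureReal_apply (measurable_gridMap n) measurableSet_Iic]
  refine ENNReal.toReal_mono (measure_ne_top _ _) (measure_mono_ae ?_)
  filter_upwards [ae_mem_unitSquare ha] with w hw h
  exact ⟨(le_gridPt hn hw.1.2).trans h.1, (le_gridPt hn hw.2.2).trans h.2⟩

theorem tendsto_integral_cdf_sub {a : Measure (ℝ × ℝ)} [IsFiniteMeasure a]
    (ha : a unitSquareᶜ = 0) :
    Tendsto (fun n ↦ ∫ z in unitSquare, (cdf a z - cdf (quantize n a) z)) atTop (𝓝 0) := by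
  have h := (tendsto_integral_quantize ha (g := fun w ↦ (1 - w.1) * (1 - w.2))
    (by fun_prop)).const_sub (∫ w, (1 - w.1) * (1 - w.2) ∂a)
  rw [sub_self] at h
  refine h.congr fun n ↦ ?_
  rw [integral_sub (integrableOn_cdf a) (integrableOn_cdf _), integral_unitSquare_cdf ha,
    integral_unitSquare_cdf (quantize_compl_unitSquare n a)]

theorem Balanced.l1Tendsto {a b : Measure (ℝ × ℝ)} [IsFiniteMeasure a] [IsFiniteMeasure b]
    (h : Balanced a b) :
    L1Tendsto (fun n ↦ cdfDist (MixedTV.quantize n a) (MixedTV.quantize n b)) (cdfDist a b) := by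
  refine ⟨_, _, fun n _ ↦ (h.quantize n).isL1Function, h.isL1Function, ?_⟩
  have hlim := (tendsto_integral_cdf_sub h.left).add (tendsto_integral_cdf_sub h.right)
  rw [add_zero] at hlim
  refine tendsto_of_tendsto_of_tendsto_of_le_of_le' tendsto_const_nhds hlim
    (.of_forall fun n ↦ integral_nonneg fun z ↦ abs_nonneg _) ?_
  filter_upwards [eventually_ge_atTop 1] with n hn
  have ia := (integrableOn_cdf a).sub (integrableOn_cdf (MixedTV.quantize n a))
  have ib := (integrableOn_cdf b).sub (integrableOn_cdf (MixedTV.quantize n b))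
  refine (integral_mono_of_nonneg (.of_forall fun z ↦ abs_nonneg _) (ia.add ib)
    (.of_forall fun z ↦ ?_)).trans_eq (integral_add ia ib)
  have h1 := cdf_quantize_le hn h.left z
  have h2 := cdf_quantize_le hn h.right z
  simp only [Pi.add_apply, Pi.sub_apply]
  exact abs_le.2 ⟨by linarith, by linarith⟩

/-! ### Convergence of the norms -/

theorem Balanced.tendsto_cdfDist_quantize {a b : Measure (ℝ × ℝ)} [IsFiniteMeasure a]
    [IsFiniteMeasure b] (h : Balanced a b) (φ : PlaneTest) :
    Tendsto (fun n ↦ cdfDist (MixedTV.quantize n a) (MixedTV.quantize n b) φ) atTop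
      (𝓝 (cdfDist a b φ)) := by
  have hc := (contDiff_quadInt φ).continuous
  simp only [(h.quantize _).cdfDist_apply_quadInt, h.cdfDist_apply_quadInt]
  exact (tendsto_integral_quantize h.left hc).sub (tendsto_integral_quantize h.right hc)

/-- Testing the image measure with `φ` is testing the original with `φ ∘ gridMap n`, which is still
bounded by `1`. -/
theorem Balanced.measureNorm_mixedDeriv_quantize_le {a b : Measure (ℝ × ℝ)} [IsFiniteMeasure a]
    [IsFiniteMeasure b] (h : Balanced a b) (n : ℕ) :
    measureNorm (mixedDeriv (cdfDist (MixedTV.quantize n a) (MixedTV.quantize n b))) ≤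
      measureNorm (mixedDeriv (cdfDist a b)) := by
  refine measureNorm_le_of_forall (supportedInSquare_diff (h.quantize n).left
    (h.quantize n).right) (h.quantize n).isMeasure_mixedDeriv fun φ hφ ↦ ?_
  rw [isMeasure_diff_iff.1 (h.quantize n).isMeasure_mixedDeriv φ,
    integral_quantize n a φ.continuous.measurable, integral_quantize n b φ.continuous.measurable]
  exact ofReal_integral_diff_le_measureNorm (supportedInSquare_diff h.left h.right)
    h.isMeasure_mixedDeriv (φ.continuous.measurable.comp (measurable_gridMap n)) fun x ↦ hφ _

theorem ofReal_sub_le_add {p q p' q' ε δ : ℝ} {c : ℝ≥0∞} (hp : |p - p'| ≤ ε) (hq : |q - q'| ≤ δ)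
    (h : ENNReal.ofReal (p' - q') ≤ c) :
    ENNReal.ofReal (p - q) ≤ c + ENNReal.ofReal (ε + δ) := by
  refine (ENNReal.ofReal_le_ofReal (?_ : p - q ≤ (p' - q') + (ε + δ))).trans
    (ENNReal.ofReal_add_le.trans (add_le_add_left h _))
  linarith [(abs_le.1 hp).2, (abs_le.1 hq).1]

/-- After an error of order `1 / n`, `φ` is replaced by `φ` with rounded abscissa, an admissible
function for the norm of the unquantized derivative. -/
theorem Balanced.measureNorm_dxI_quantize_le {a b : Measure (ℝ × ℝ)} [IsFiniteMeasure a]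
    [IsFiniteMeasure b] (h : Balanced a b) {n : ℕ} (hn : 1 ≤ n) :
    measureNorm (dxI (cdfDist (MixedTV.quantize n a) (MixedTV.quantize n b))) ≤
      measureNorm (dxI (cdfDist a b)) +
        ENNReal.ofReal (1 / n * a.real Set.univ + 1 / n * b.real Set.univ) := by
  refine measureNorm_le_of_forall (supportedInSquare_diff
    (edgeFst_compl_unitSquare (h.quantize n).left)
    (edgeFst_compl_unitSquare (h.quantize n).right)) (h.quantize n).isMeasure_dxI fun φ hφ ↦ ?_
  rw [isMeasure_diff_iff.1 (h.quantize n).isMeasure_dxI φ]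
  refine ofReal_sub_le_add
    (abs_integral_edgeFst_quantize_sub_le hn h.left φ.continuous.measurable hφ)
    (abs_integral_edgeFst_quantize_sub_le hn h.right φ.continuous.measurable hφ)
    (ofReal_integral_diff_le_measureNorm (supportedInSquare_diff
      (edgeFst_compl_unitSquare h.left) (edgeFst_compl_unitSquare h.right)) h.isMeasure_dxI
      (φ.continuous.measurable.comp
        (((measurable_gridPt n).comp measurable_fst).prodMk measurable_snd)) fun x ↦ hφ _)

theorem Balanced.measureNorm_iXd_quantize_le {a b : Measure (ℝ × ℝ)} [IsFiniteMeasure a]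
    [IsFiniteMeasure b] (h : Balanced a b) {n : ℕ} (hn : 1 ≤ n) :
    measureNorm (iXd (cdfDist (MixedTV.quantize n a) (MixedTV.quantize n b))) ≤
      measureNorm (iXd (cdfDist a b)) +
        ENNReal.ofReal (1 / n * a.real Set.univ + 1 / n * b.real Set.univ) := by
  refine measureNorm_le_of_forall (supportedInSquare_diff
    (edgeSnd_compl_unitSquare (h.quantize n).left)
    (edgeSnd_compl_unitSquare (h.quantize n).right)) (h.quantize n).isMeasure_iXd fun φ hφ ↦ ?_
  rw [isMeasure_diff_iff.1 (h.quantize n).isMeasure_iXd φ]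
  refine ofReal_sub_le_add
    (abs_integral_edgeSnd_quantize_sub_le hn h.left φ.continuous.measurable hφ)
    (abs_integral_edgeSnd_quantize_sub_le hn h.right φ.continuous.measurable hφ)
    (ofReal_integral_diff_le_measureNorm (supportedInSquare_diff
      (edgeSnd_compl_unitSquare h.left) (edgeSnd_compl_unitSquare h.right)) h.isMeasure_iXd
      (φ.continuous.measurable.comp
        (measurable_fst.prodMk ((measurable_gridPt n).comp measurable_snd))) fun x ↦ hφ _)

theorem tendsto_ofReal_one_div_mul (p q : ℝ) :
    Tendsto (fun n : ℕ ↦ ENNReal.ofReal (1 / n * p + 1 / n * q)) atTop (𝓝 0) := by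
  have h := (tendsto_one_div_atTop_nhds_zero_nat (𝕜 := ℝ)).mul_const p
  have h' := (tendsto_one_div_atTop_nhds_zero_nat (𝕜 := ℝ)).mul_const q
  simpa [Function.comp_def] using (ENNReal.continuous_ofReal.tendsto _).comp (h.add h')

theorem Balanced.gradNorm_lt_top {a b : Measure (ℝ × ℝ)} [IsFiniteMeasure a]
    [IsFiniteMeasure b] (h : Balanced a b) : gradNorm (cdfDist a b) < ∞ :=
  ENNReal.add_lt_top.2
    ⟨measureNorm_lt_top (supportedInSquare_diff (edgeSnd_compl_unitSquare h.left)
      (edgeSnd_compl_unitSquare h.right)) h.isMeasure_iXd,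
    measureNorm_lt_top (supportedInSquare_diff (edgeFst_compl_unitSquare h.left)
      (edgeFst_compl_unitSquare h.right)) h.isMeasure_dxI⟩

theorem Balanced.tendsto_gradNorm_quantize {a b : Measure (ℝ × ℝ)} [IsFiniteMeasure a]
    [IsFiniteMeasure b] (h : Balanced a b) :
    Tendsto (fun n ↦ gradNorm (cdfDist (MixedTV.quantize n a) (MixedTV.quantize n b))) atTop
      (𝓝 (gradNorm (cdfDist a b))) := by
  have hε := tendsto_ofReal_one_div_mul (a.real Set.univ) (b.real Set.univ)
  refine Tendsto.add ?_ ?_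
  · refine tendsto_measureNorm (supportedInSquare_diff (edgeSnd_compl_unitSquare h.left)
      (edgeSnd_compl_unitSquare h.right)) h.isMeasure_iXd
      (fun n ↦ supportedInSquare_diff (edgeSnd_compl_unitSquare (h.quantize n).left)
        (edgeSnd_compl_unitSquare (h.quantize n).right)) (fun n ↦ (h.quantize n).isMeasure_iXd)
      (fun φ ↦ ?_) hε ?_
    · simp only [iXd_apply]
      exact (h.tendsto_cdfDist_quantize _).neg
    · filter_upwards [eventually_ge_atTop 1] with n hn using h.measureNorm_iXd_quantize_le hn
  · refine tendsto_measureNorm (supportedInSquare_diff (edgeFst_compl_unitSquare h.left)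
      (edgeFst_compl_unitSquare h.right)) h.isMeasure_dxI
      (fun n ↦ supportedInSquare_diff (edgeFst_compl_unitSquare (h.quantize n).left)
        (edgeFst_compl_unitSquare (h.quantize n).right)) (fun n ↦ (h.quantize n).isMeasure_dxI)
      (fun φ ↦ ?_) hε ?_
    · simp only [dxI_apply]
      exact (h.tendsto_cdfDist_quantize _).neg
    · filter_upwards [eventually_ge_atTop 1] with n hn using h.measureNorm_dxI_quantize_le hn

theorem Balanced.tendsto_measureNorm_mixedDeriv_quantize {a b : Measure (ℝ × ℝ)}
    [IsFiniteMeasure a] [IsFiniteMeasure b] (h : Balanced a b) :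
    Tendsto (fun n ↦ measureNorm (mixedDeriv
        (cdfDist (MixedTV.quantize n a) (MixedTV.quantize n b)))) atTop
      (𝓝 (measureNorm (mixedDeriv (cdfDist a b)))) := by
  refine tendsto_measureNorm (supportedInSquare_diff h.left h.right) h.isMeasure_mixedDeriv
    (fun n ↦ supportedInSquare_diff (h.quantize n).left (h.quantize n).right)
    (fun n ↦ (h.quantize n).isMeasure_mixedDeriv) (fun φ ↦ ?_) tendsto_const_nhds
    (.of_forall fun n ↦ by simpa using h.measureNorm_mixedDeriv_quantize_le n)
  simp only [mixedDeriv_apply]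
  exact h.tendsto_cdfDist_quantize _

theorem NativeSpace.pairing_eq_of_mixedMeasure_eq {f : NativeSpace} {a b : Measure (ℝ × ℝ)}
    [IsFiniteMeasure a] [IsFiniteMeasure b] (hf : f.mixedMeasure = diff a b)
    (φ : C₀(ℝ × ℝ, ℝ)) : f.pairing φ = ∫ w, φ w ∂a - ∫ w, φ w ∂b := by
  have hφ (x : ℝ × ℝ) : |φ x| ≤ ‖φ.toBCF‖ := φ.toBCF.norm_coe_le_norm x
  have hm : Measurable φ := φ.continuous.measurable
  rw [NativeSpace.pairing, hf, integral_diff (integrable_of_measurable_of_bound hm hφ)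
    (integrable_of_measurable_of_bound hm hφ)]

end MixedTV

end

/-! ### The approximation theorem -/

theorem mainTheorem11 (f : MixedTV.NativeSpace) :
    ∃ F : ℕ → MixedTV.NativeSpace,
      (∀ n, 1 ≤ n → MixedTV.IsGridMeasure n (F n).mixedMeasure) ∧
      -- 1. weak* convergence
      MixedTV.NativeSpace.WeakStarTendsto F f ∧
      -- 2. the norm of the mixed derivative
      (f.mixedNorm < ∞ ∧ (∀ n, 1 ≤ n → (F n).mixedNorm ≤ f.mixedNorm) ∧
        Tendsto (fun n ↦ (F n).mixedNorm) atTop (𝓝 f.mixedNorm)) ∧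
      -- 3. convergence in `L¹(K)`
      MixedTV.L1Tendsto (fun n ↦ (F n).toDistribution) f.toDistribution ∧
      -- 4. the norm of the gradient
      (MixedTV.gradNorm f.toDistribution < ∞ ∧
        (∀ n, 1 ≤ n → MixedTV.gradNorm (F n).toDistribution < ∞) ∧
        Tendsto (fun n ↦ MixedTV.gradNorm (F n).toDistribution) atTop
          (𝓝 (MixedTV.gradNorm f.toDistribution))) := by
  obtain ⟨a, b, _, _, ha, hb, hf⟩ := MixedTV.exists_diff_eq f.mixedMeasure_supported
  have h := f.balanced ha hb hf
  have hd : f.toDistribution = MixedTV.cdfDist a b := f.toDistribution_eq_cdfDist ha hb hf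
  have hm (n : ℕ) := (h.quantize n).mixedMeasure_toNative
  refine ⟨fun n ↦ (h.quantize n).toNative, fun n hn ↦ ?_, fun φ ↦ ?_, ⟨?_, fun n _ ↦ ?_, ?_⟩,
    ?_, ?_, fun n _ ↦ (h.quantize n).gradNorm_lt_top, ?_⟩
  · rw [hm]
    exact MixedTV.isGridMeasure_quantize hn a b
  · simp only [MixedTV.NativeSpace.pairing_eq_of_mixedMeasure_eq (hm _),
      MixedTV.NativeSpace.pairing_eq_of_mixedMeasure_eq hf]
    exact (MixedTV.tendsto_integral_quantize ha φ.continuous).sub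
      (MixedTV.tendsto_integral_quantize hb φ.continuous)
  · exact MixedTV.measureNorm_lt_top f.mixedMeasure_supported f.isMeasure_mixedMeasure
  · rw [MixedTV.NativeSpace.mixedNorm, MixedTV.NativeSpace.mixedNorm, hd]
    exact h.measureNorm_mixedDeriv_quantize_le n
  · simp only [MixedTV.NativeSpace.mixedNorm, hd]
    exact h.tendsto_measureNorm_mixedDeriv_quantize
  · rw [hd]
    exact h.l1Tendsto
  · rw [hd]
    exact h.gradNorm_lt_top
  · rw [hd]
    exact h.tendsto_gradNorm_quantize
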